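/- Let $F$ be an algebraically closed field of characteristic different from $2$ and $3$. Let $K_3=Fe\oplus(Fx+Fy)$ be the Kaplansky superalgebra, with even part $Fe$, odd part $Fx+Fy$ and supercommutative product $e^2=e$, $ex=\frac12x$, $ey=\frac12y$, $xy=e=-yx$, $x^2=y^2=0$, and let $(\cdot|\cdot)$ be the supersymmetric bilinear form on $K_3$ with $(e|e)=\frac12$, $(x|y)=1=-(y|x)$, $(x|x)=(y|y)=0$ and $e$ orthogonal to $x,y$. Let $K_{10}=F1\oplus(K_3\otimes K_3)$ be the superalgebra in which $1$ is an even unit, $a\otimes b$ has degree $\bar a+\bar b$, and $$(a\otimes b)(c\otimes d)=(-1)^{\bar b\bar c}\Bigl(ac\otimes bd-\tfrac34\,(a|c)(b|d)\,1\Bigr)$$ for homogeneous $a,b,c,d\in K_3$. Subalgebras are graded subalgebras (not required to contain $1$), a maximal subalgebra is a maximal element among the proper ones, and automorphisms preserve the grading. The linear map $\varphi$ of $K_{10}$ given by $\varphi(1)=1$ and $\varphi(a\otimes b)=(-1)^{\bar a\bar b}\,b\otimes a$ for homogeneous $a,b$ is an automorphism of $K_{10}$, and $M=Fe+Fx$ is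 a maximal subalgebra of $K_3$. A subspace of $K_{10}$ is a maximal subalgebra if and only if some automorphism of $K_{10}$ carries it onto one of the following: (i) the even part $(K_{10})_{\bar0}$; (ii) the subalgebra of the elements fixed by $\varphi$; (iii) $F1\oplus(M\otimes K_3)$; (iv) $F1+F(e\otimes e)+(x\otimes K_3)+(K_3\otimes y)$. No two of these four are conjugate under automorphisms of $K_{10}$. -/

import Mathlib

open scoped TensorProduct

/-- A (not necessarily associative) superalgebra over `F` with underlying vector space `A`:
a bilinear product and a decomposition `A = A₀ ⊕ A₁` with `Aᵢ Aⱼ ⊆ Aᵢ₊ⱼ`. -/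
structure Superalg (F A : Type*) [Field F] [AddCommGroup A] [Module F A] where
  mul : A →ₗ[F] A →ₗ[F] A
  part : ZMod 2 → Submodule F A
  isCompl : IsCompl (part 0) (part 1)
  mul_mem : ∀ i j : ZMod 2, ∀ a ∈ part i, ∀ b ∈ part j, mul a b ∈ part (i + j)

namespace Superalg

variable {F A : Type*} [Field F] [AddCommGroup A] [Module F A]

/-- Subalgebras in the graded sense: subspaces that are closed under the product and are the
sum of their intersections with the even and the odd part. They need not contain a unit. -/
structure IsSubalg (S : Superalg F A) (B : Submodule F A) : Prop where
  mul_mem : ∀ a ∈ B, ∀ b ∈ B, S.mul a b ∈ B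
  graded : B = (B ⊓ S.part 0) ⊔ (B ⊓ S.part 1)

/-- Maximal subalgebras: the maximal elements among the proper graded subalgebras. -/
def IsMaximalSubalg (S : Superalg F A) (B : Submodule F A) : Prop :=
  Maximal (fun C : Submodule F A => S.IsSubalg C ∧ C ≠ ⊤) B

/-- `g` is an automorphism of the superalgebra, that is, of the graded algebra. -/
structure IsAut (S : Superalg F A) (g : A ≃ₗ[F] A) : Prop where
  map_mul : ∀ a b, g (S.mul a b) = S.mul (g a) (g b)
  map_part : ∀ i : ZMod 2, (S.part i).map (g : A →ₗ[F] A) = S.part i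

/-- `B` and `C` are conjugate: some automorphism carries `B` onto `C`. -/
def Conjugate (S : Superalg F A) (B C : Submodule F A) : Prop :=
  ∃ g : A ≃ₗ[F] A, S.IsAut g ∧ B.map (g : A →ₗ[F] A) = C

end Superalg

/-- The vector space `F e + F x + F y` underlying the Kaplansky superalgebra, in coordinates.
Its product is `K3.mul` below, not the pointwise one. -/
abbrev K3 (F : Type*) : Type _ := Fin 3 → F

namespace K3

variable (F : Type*) [Field F]

def e : K3 F := ![1, 0, 0]

def x : K3 F := ![0, 1, 0]

def y : K3 F := ![0, 0, 1]

/-- The supercommutative product with `e² = e`, `e x = x / 2`, `e y = y / 2`, `x y = e`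
(so `x e = x / 2`, `y e = y / 2`, `y x = -e`, `x² = y² = 0`). -/
def mul : K3 F →ₗ[F] K3 F →ₗ[F] K3 F :=
  LinearMap.mk₂ F
    (fun a b => ![a 0 * b 0 + a 1 * b 2 - a 2 * b 1,
      (2 : F)⁻¹ * (a 0 * b 1 + a 1 * b 0), (2 : F)⁻¹ * (a 0 * b 2 + a 2 * b 0)])
    (by intro a a' b; ext k; fin_cases k <;> simp <;> ring)
    (by intro c a b; ext k; fin_cases k <;> simp <;> ring)
    (by intro a b b'; ext k; fin_cases k <;> simp <;> ring)
    (by intro c a b; ext k; fin_cases k <;> simp <;> ring)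

/-- The supersymmetric bilinear form with `(e|e) = 1/2`, `(x|y) = 1 = -(y|x)`,
`(x|x) = (y|y) = 0` and orthogonal even and odd parts. -/
def form : K3 F →ₗ[F] K3 F →ₗ[F] F :=
  LinearMap.mk₂ F (fun a b => (2 : F)⁻¹ * (a 0 * b 0) + a 1 * b 2 - a 2 * b 1)
    (by intro a a' b; simp; ring)
    (by intro c a b; simp; ring)
    (by intro a b b'; simp; ring)
    (by intro c a b; simp; ring)

/-- The homogeneous parts: `F e` is even and `F x + F y` is odd. -/
def part (i : ZMod 2) : Submodule F (K3 F) :=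
  if i = 0 then Submodule.span F {e F} else Submodule.span F {x F, y F}

/-- The projections of `K3` onto its homogeneous parts. -/
def proj (i : ZMod 2) : K3 F →ₗ[F] K3 F :=
  if i = 0 then
    { toFun := fun a => ![a 0, 0, 0]
      map_add' := by intro a b; ext k; fin_cases k <;> simp
      map_smul' := by intro c a; ext k; fin_cases k <;> simp }
  else
    { toFun := fun a => ![0, a 1, a 2]
      map_add' := by intro a b; ext k; fin_cases k <;> simp
      map_smul' := by intro c a; ext k; fin_cases k <;> simp }

variable {F}

theorem eq_zero_or_one (i : ZMod 2) : i = 0 ∨ i = 1 := by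
  revert i; decide

theorem proj_zero (a : K3 F) : proj F 0 a = ![a 0, 0, 0] := by
  rw [proj, if_pos rfl]; rfl

theorem proj_one (a : K3 F) : proj F 1 a = ![0, a 1, a 2] := by
  rw [proj, if_neg (by decide)]; rfl

theorem mem_part_zero {a : K3 F} : a ∈ part F 0 ↔ a 1 = 0 ∧ a 2 = 0 := by
  rw [part, if_pos rfl, Submodule.mem_span_singleton]
  constructor
  · rintro ⟨c, rfl⟩; simp [e]
  · rintro ⟨h1, h2⟩
    refine ⟨a 0, ?_⟩
    ext k; fin_cases k <;> simp [e, h1, h2]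

theorem mem_part_one {a : K3 F} : a ∈ part F 1 ↔ a 0 = 0 := by
  rw [part, if_neg (by decide), Submodule.mem_span_pair]
  constructor
  · rintro ⟨c, d, rfl⟩; simp [x, y]
  · intro h
    refine ⟨a 1, a 2, ?_⟩
    ext k; fin_cases k <;> simp [x, y, h]

theorem proj_mem (i : ZMod 2) (a : K3 F) : proj F i a ∈ part F i := by
  obtain rfl | rfl := eq_zero_or_one i
  · exact mem_part_zero.2 (by simp [proj_zero])
  · exact mem_part_one.2 (by simp [proj_one])

theorem proj_of_mem {i : ZMod 2} (j : ZMod 2) {a : K3 F} (ha : a ∈ part F i) :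
    proj F j a = if j = i then a else 0 := by
  obtain rfl | rfl := eq_zero_or_one i <;> obtain rfl | rfl := eq_zero_or_one j
  · obtain ⟨h1, h2⟩ := mem_part_zero.1 ha
    rw [if_pos rfl, proj_zero]
    ext k; fin_cases k <;> simp [h1, h2]
  · obtain ⟨h1, h2⟩ := mem_part_zero.1 ha
    rw [if_neg (by decide), proj_one]
    ext k; fin_cases k <;> simp [h1, h2]
  · have h := mem_part_one.1 ha
    rw [if_neg (by decide), proj_zero]
    ext k; fin_cases k <;> simp [h]
  · have h := mem_part_one.1 ha
    rw [if_pos rfl, proj_one]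
    ext k; fin_cases k <;> simp [h]

theorem proj_add (a : K3 F) : proj F 0 a + proj F 1 a = a := by
  rw [proj_zero, proj_one]
  ext k; fin_cases k <;> simp

theorem mul_mem (i j : ZMod 2) (a : K3 F) (ha : a ∈ part F i) (b : K3 F) (hb : b ∈ part F j) :
    mul F a b ∈ part F (i + j) := by
  fin_cases i <;> fin_cases j
  · obtain ⟨h1, h2⟩ := mem_part_zero.1 ha
    obtain ⟨h3, h4⟩ := mem_part_zero.1 hb
    exact mem_part_zero.2 (by simp [mul, h1, h2, h3, h4])
  · obtain ⟨h1, h2⟩ := mem_part_zero.1 ha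
    have h3 := mem_part_one.1 hb
    exact mem_part_one.2 (by simp [mul, h1, h2, h3])
  · have h3 := mem_part_one.1 ha
    obtain ⟨h1, h2⟩ := mem_part_zero.1 hb
    exact mem_part_one.2 (by simp [mul, h1, h2, h3])
  · have h1 := mem_part_one.1 ha
    have h2 := mem_part_one.1 hb
    exact mem_part_zero.2 (by simp [mul, h1, h2])

theorem form_eq_zero {i j : ZMod 2} (hij : i + j ≠ 0) {a b : K3 F} (ha : a ∈ part F i)
    (hb : b ∈ part F j) : form F a b = 0 := by
  fin_cases i <;> fin_cases j
  · exact absurd rfl hij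
  · obtain ⟨h1, h2⟩ := mem_part_zero.1 ha
    have h3 := mem_part_one.1 hb
    simp [form, h1, h2, h3]
  · have h3 := mem_part_one.1 ha
    obtain ⟨h1, h2⟩ := mem_part_zero.1 hb
    simp [form, h1, h2, h3]
  · exact absurd rfl hij

variable (F)

theorem isCompl_part : IsCompl (part F 0) (part F 1) := by
  constructor
  · rw [Submodule.disjoint_def]
    intro a h0 h1
    have := proj_of_mem 0 h0
    rw [proj_of_mem 0 h1] at this
    simpa using this.symm
  · rw [codisjoint_iff, Submodule.eq_top_iff']
    intro a
    rw [← proj_add a]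
    exact Submodule.add_mem_sup (proj_mem 0 a) (proj_mem 1 a)

/-- The Kaplansky superalgebra. -/
def superalg : Superalg F (K3 F) where
  mul := mul F
  part := part F
  isCompl := isCompl_part F
  mul_mem := mul_mem

/-- The subspace `M = F e + F x` of `K3`. -/
def M : Submodule F (K3 F) := Submodule.span F {e F, x F}

end K3

/-- The vector space `F 1 ⊕ (K3 ⊗ K3)`; the pair `(r, u)` stands for `r 1 + u`.
Its product is `K10.mul` below. -/
abbrev K10 (F : Type*) [Field F] : Type _ := F × (K3 F ⊗[F] K3 F)

namespace K10

variable (F : Type*) [Field F]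

/-- The bilinear map on `K3 ⊗ K3` with `(a ⊗ b, c ⊗ d) ↦ (-1)^(|b||c|) (a c) ⊗ (b d)`
for homogeneous `b`, `c`. -/
def tmul : K3 F ⊗[F] K3 F →ₗ[F] K3 F ⊗[F] K3 F →ₗ[F] K3 F ⊗[F] K3 F :=
  ∑ i : ZMod 2, ∑ j : ZMod 2, (-1 : F) ^ (i.val * j.val) •
    TensorProduct.map₂ ((K3.mul F).compl₂ (K3.proj F j)) ((K3.mul F).comp (K3.proj F i))

/-- The bilinear form on `K3 ⊗ K3` with `(a ⊗ b, c ⊗ d) ↦ (-1)^(|b||c|) (a|c) (b|d)`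
for homogeneous `b`, `c`. -/
def tform : K3 F ⊗[F] K3 F →ₗ[F] K3 F ⊗[F] K3 F →ₗ[F] F :=
  ∑ i : ZMod 2, ∑ j : ZMod 2, (-1 : F) ^ (i.val * j.val) •
    (TensorProduct.map₂ ((K3.form F).compl₂ (K3.proj F j))
      ((K3.form F).comp (K3.proj F i))).compr₂ (TensorProduct.lid F F).toLinearMap

/-- The product of `F 1 ⊕ (K3 ⊗ K3)`: `1` is a unit and
`(a ⊗ b) (c ⊗ d) = (-1)^(|b||c|) (a c ⊗ b d - (3/4) (a|c) (b|d) 1)` for homogeneous elements. -/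
def mul : K10 F →ₗ[F] K10 F →ₗ[F] K10 F :=
  LinearMap.mk₂ F
    (fun z w => (z.1 * w.1 - 3 / 4 * tform F z.2 w.2, z.1 • w.2 + w.1 • z.2 + tmul F z.2 w.2))
    (by
      intro z z' w
      ext1
      · simp; ring
      · simp only [Prod.fst_add, Prod.snd_add, map_add, LinearMap.add_apply]; module)
    (by
      intro c z w
      ext1
      · simp; ring
      · simp only [Prod.smul_fst, Prod.smul_snd, map_smul, LinearMap.smul_apply, smul_eq_mul]
        module)
    (by
      intro z w w'
      ext1
      · simp; ring
      · simp only [Prod.fst_add, Prod.snd_add, map_add]; module)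
    (by
      intro c z w
      ext1
      · simp; ring
      · simp only [Prod.smul_fst, Prod.smul_snd, map_smul, smul_eq_mul]
        module)

/-- The part of degree `i` of `K3 ⊗ K3`, namely the sum of the `(K3)ⱼ ⊗ (K3)ᵢ₋ⱼ`. -/
def tpart (i : ZMod 2) : Submodule F (K3 F ⊗[F] K3 F) :=
  ⨆ j : ZMod 2, Submodule.map₂ (TensorProduct.mk F (K3 F) (K3 F)) (K3.part F j)
    (K3.part F (i - j))

/-- The homogeneous parts of `F 1 ⊕ (K3 ⊗ K3)`, where `1` is even. -/
def part (i : ZMod 2) : Submodule F (K10 F) :=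
  (if i = 0 then (⊤ : Submodule F F) else ⊥).prod (tpart F i)

variable {F}

theorem tmul_tmul {j k : ZMod 2} (a d : K3 F) {b c : K3 F} (hb : b ∈ K3.part F j)
    (hc : c ∈ K3.part F k) :
    tmul F (a ⊗ₜ b) (c ⊗ₜ d) = (-1 : F) ^ (j.val * k.val) • (K3.mul F a c ⊗ₜ K3.mul F b d) := by
  simp only [tmul, LinearMap.sum_apply, LinearMap.smul_apply, TensorProduct.map₂_apply_tmul,
    LinearMap.comp_apply, K3.proj_of_mem _ hb]
  rw [Finset.sum_eq_single j, Finset.sum_eq_single k]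
  · simp [K3.proj_of_mem _ hc]
  · intro b' _ hb'; simp [K3.proj_of_mem _ hc, hb']
  · simp
  · intro b' _ hb'; simp [hb']
  · simp

theorem tform_tmul {j k : ZMod 2} (a d : K3 F) {b c : K3 F} (hb : b ∈ K3.part F j)
    (hc : c ∈ K3.part F k) :
    tform F (a ⊗ₜ b) (c ⊗ₜ d) = (-1 : F) ^ (j.val * k.val) * (K3.form F a c * K3.form F b d) := by
  simp only [tform, LinearMap.sum_apply, LinearMap.smul_apply, LinearMap.compr₂_apply,
    TensorProduct.map₂_apply_tmul,
    LinearMap.comp_apply, K3.proj_of_mem _ hb]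
  rw [Finset.sum_eq_single j, Finset.sum_eq_single k]
  · simp [K3.proj_of_mem _ hc]
  · intro b' _ hb'; simp [K3.proj_of_mem _ hc, hb']
  · simp
  · intro b' _ hb'; simp [hb']
  · simp

/-- The product of pure tensors of homogeneous elements. -/
theorem mul_tmul {j k : ZMod 2} (a d : K3 F) {b c : K3 F} (hb : b ∈ K3.part F j)
    (hc : c ∈ K3.part F k) :
    mul F (0, a ⊗ₜ b) (0, c ⊗ₜ d) = (-1 : F) ^ (j.val * k.val) •
      ((0, K3.mul F a c ⊗ₜ K3.mul F b d) -
        (3 / 4 * (K3.form F a c * K3.form F b d)) • ((1, 0) : K10 F)) := by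
  ext1
  · simp [mul, tform_tmul a d hb hc]; ring
  · simp [mul, tmul_tmul a d hb hc]

theorem tmul_mem_tpart {j k : ZMod 2} {a b : K3 F} (ha : a ∈ K3.part F j)
    (hb : b ∈ K3.part F k) : a ⊗ₜ[F] b ∈ tpart F (j + k) := by
  refine Submodule.mem_iSup_of_mem j ?_
  rw [add_sub_cancel_left]
  exact Submodule.apply_mem_map₂ (TensorProduct.mk F (K3 F) (K3 F)) ha hb

theorem tpart_le {i : ZMod 2} {P : Submodule F (K3 F ⊗[F] K3 F)}
    (h : ∀ j k : ZMod 2, j + k = i → ∀ a ∈ K3.part F j, ∀ b ∈ K3.part F k, a ⊗ₜ[F] b ∈ P) :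
    tpart F i ≤ P :=
  iSup_le fun j => Submodule.map₂_le.2 fun a ha b hb => h j (i - j) (by ring) a ha b hb

theorem tmul_mem (i j : ZMod 2) (u : K3 F ⊗[F] K3 F) (hu : u ∈ tpart F i)
    (v : K3 F ⊗[F] K3 F) (hv : v ∈ tpart F j) : tmul F u v ∈ tpart F (i + j) := by
  have h1 : tpart F i ≤ (tpart F (i + j)).comap ((tmul F).flip v) := by
    refine tpart_le fun k l hkl a ha b hb => ?_
    have h2 : tpart F j ≤ (tpart F (i + j)).comap (tmul F (a ⊗ₜ b)) := by
      refine tpart_le fun m n hmn c hc d hd => ?_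
      rw [Submodule.mem_comap, tmul_tmul a d hb hc]
      refine Submodule.smul_mem _ _ ?_
      have := tmul_mem_tpart (K3.mul_mem k m a ha c hc) (K3.mul_mem l n b hb d hd)
      rwa [show k + m + (l + n) = i + j by rw [← hkl, ← hmn]; ring] at this
    exact h2 hv
  exact h1 hu

theorem tform_eq_zero {i j : ZMod 2} (hij : i + j ≠ 0) (u : K3 F ⊗[F] K3 F)
    (hu : u ∈ tpart F i) (v : K3 F ⊗[F] K3 F) (hv : v ∈ tpart F j) : tform F u v = 0 := by
  have h1 : tpart F i ≤ LinearMap.ker ((tform F).flip v) := by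
    refine tpart_le fun k l hkl a ha b hb => ?_
    have h2 : tpart F j ≤ LinearMap.ker (tform F (a ⊗ₜ b)) := by
      refine tpart_le fun m n hmn c hc d hd => ?_
      rw [LinearMap.mem_ker, tform_tmul a d hb hc]
      by_cases h : k + m = 0
      · have h' : l + n ≠ 0 := by
          intro h'
          apply hij
          rw [← hkl, ← hmn, show k + l + (m + n) = (k + m) + (l + n) by ring, h, h', add_zero]
        rw [K3.form_eq_zero h' hb hd]; simp
      · rw [K3.form_eq_zero h ha hc]; simp
    exact h2 hv
  exact h1 hu

theorem mul_mem (i j : ZMod 2) (z : K10 F) (hz : z ∈ part F i) (w : K10 F)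
    (hw : w ∈ part F j) : mul F z w ∈ part F (i + j) := by
  obtain ⟨hz1, hz2⟩ := Submodule.mem_prod.1 hz
  obtain ⟨hw1, hw2⟩ := Submodule.mem_prod.1 hw
  refine Submodule.mem_prod.2 ⟨?_, ?_⟩
  · by_cases hij : i + j = 0
    · simp [hij]
    · have h0 : z.1 * w.1 = 0 := by
        by_cases hi : i = 0
        · have hj : j ≠ 0 := fun hj => hij (by rw [hi, hj, add_zero])
          rw [if_neg hj] at hw1
          rw [(Submodule.mem_bot F).1 hw1, mul_zero]
        · rw [if_neg hi] at hz1
          rw [(Submodule.mem_bot F).1 hz1, zero_mul]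
      simp [mul, h0, hij, tform_eq_zero hij z.2 hz2 w.2 hw2]
  · have h1 : z.1 • w.2 ∈ tpart F (i + j) := by
      by_cases hi : i = 0
      · rw [hi, zero_add]; exact Submodule.smul_mem _ _ hw2
      · rw [if_neg hi] at hz1
        rw [(Submodule.mem_bot F).1 hz1, zero_smul]; exact Submodule.zero_mem _
    have h2 : w.1 • z.2 ∈ tpart F (i + j) := by
      by_cases hj : j = 0
      · rw [hj, add_zero]; exact Submodule.smul_mem _ _ hz2
      · rw [if_neg hj] at hw1
        rw [(Submodule.mem_bot F).1 hw1, zero_smul]; exact Submodule.zero_mem _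
    exact Submodule.add_mem _ (Submodule.add_mem _ h1 h2) (tmul_mem i j _ hz2 _ hw2)

variable (F)

theorem isCompl_tpart : IsCompl (tpart F 0) (tpart F 1) := by
  let p : K3 F ⊗[F] K3 F →ₗ[F] K3 F ⊗[F] K3 F :=
    TensorProduct.map (K3.proj F 0) (K3.proj F 0) + TensorProduct.map (K3.proj F 1) (K3.proj F 1)
  have h0 : tpart F 0 ≤ LinearMap.eqLocus p LinearMap.id := by
    refine tpart_le fun j k hjk a ha b hb => ?_
    rw [LinearMap.mem_eqLocus]
    simp only [p, LinearMap.add_apply, TensorProduct.map_tmul, K3.proj_of_mem _ ha,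
      K3.proj_of_mem _ hb, LinearMap.id_apply]
    obtain rfl | rfl := K3.eq_zero_or_one j <;> obtain rfl | rfl := K3.eq_zero_or_one k <;>
      first | (exact absurd hjk (by decide)) | simp
  have h1 : tpart F 1 ≤ LinearMap.ker p := by
    refine tpart_le fun j k hjk a ha b hb => ?_
    rw [LinearMap.mem_ker]
    simp only [p, LinearMap.add_apply, TensorProduct.map_tmul, K3.proj_of_mem _ ha,
      K3.proj_of_mem _ hb]
    obtain rfl | rfl := K3.eq_zero_or_one j <;> obtain rfl | rfl := K3.eq_zero_or_one k <;>
      first | (exact absurd hjk (by decide)) | simp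
  constructor
  · rw [Submodule.disjoint_def]
    intro u hu0 hu1
    have e0 : p u = u := h0 hu0
    have e1 : p u = 0 := h1 hu1
    rw [← e0, e1]
  · rw [codisjoint_iff, Submodule.eq_top_iff']
    intro u
    induction u using TensorProduct.induction_on with
    | zero => exact Submodule.zero_mem _
    | add u v hu hv => exact Submodule.add_mem _ hu hv
    | tmul a b =>
      rw [← K3.proj_add a, ← K3.proj_add b, TensorProduct.add_tmul, TensorProduct.tmul_add,
        TensorProduct.tmul_add]
      have h (i j : ZMod 2) := tmul_mem_tpart (K3.proj_mem i a) (K3.proj_mem j b)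
      exact Submodule.add_mem _
        (Submodule.add_mem _ (Submodule.mem_sup_left (h 0 0)) (Submodule.mem_sup_right (h 0 1)))
        (Submodule.add_mem _ (Submodule.mem_sup_right (h 1 0)) (Submodule.mem_sup_left (h 1 1)))

theorem isCompl_part : IsCompl (part F 0) (part F 1) := by
  have h := isCompl_tpart F
  constructor
  · rw [Submodule.disjoint_def]
    rintro ⟨r, u⟩ h0 h1
    obtain ⟨-, hu0⟩ := Submodule.mem_prod.1 h0
    obtain ⟨hr, hu1⟩ := Submodule.mem_prod.1 h1
    rw [if_neg (by decide)] at hr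
    exact Prod.ext ((Submodule.mem_bot F).1 hr) ((Submodule.disjoint_def.1 h.disjoint) u hu0 hu1)
  · rw [codisjoint_iff, Submodule.eq_top_iff']
    rintro ⟨r, u⟩
    have hu : u ∈ tpart F 0 ⊔ tpart F 1 := by rw [h.sup_eq_top]; trivial
    obtain ⟨v, hv, w, hw, rfl⟩ := Submodule.mem_sup.1 hu
    refine Submodule.mem_sup.2 ⟨(r, v), ?_, (0, w), ?_, by simp⟩
    · exact Submodule.mem_prod.2 ⟨by simp, hv⟩
    · exact Submodule.mem_prod.2 ⟨Submodule.zero_mem _, hw⟩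

/-- The Kac superalgebra `K10 = F 1 ⊕ (K3 ⊗ K3)`. -/
def superalg : Superalg F (K10 F) where
  mul := mul F
  part := part F
  isCompl := isCompl_part F
  mul_mem := mul_mem

/-- The swap of the two tensor factors, `a ⊗ b ↦ (-1)^(|a||b|) b ⊗ a` for homogeneous `a`, `b`. -/
def tswap : K3 F ⊗[F] K3 F →ₗ[F] K3 F ⊗[F] K3 F :=
  ∑ i : ZMod 2, ∑ j : ZMod 2, (-1 : F) ^ (i.val * j.val) •
    (TensorProduct.comm F (K3 F) (K3 F)).toLinearMap.comp
      (TensorProduct.map (K3.proj F i) (K3.proj F j))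

/-- The map `φ` with `φ(r 1 + a ⊗ b) = r 1 + (-1)^(|a||b|) b ⊗ a` for homogeneous `a`, `b`. -/
def swap : K10 F →ₗ[F] K10 F := LinearMap.id.prodMap (tswap F)

variable {F} in
theorem swap_tmul {i j : ZMod 2} (r : F) {a b : K3 F} (ha : a ∈ K3.part F i)
    (hb : b ∈ K3.part F j) :
    swap F (r, a ⊗ₜ b) = (r, (-1 : F) ^ (i.val * j.val) • (b ⊗ₜ a)) := by
  ext1
  · simp [swap]
  simp only [swap, LinearMap.prodMap_apply, tswap, LinearMap.sum_apply, LinearMap.smul_apply,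
    LinearMap.comp_apply, TensorProduct.map_tmul, K3.proj_of_mem _ ha, K3.proj_of_mem _ hb]
  rw [Finset.sum_eq_single i, Finset.sum_eq_single j]
  · simp
  · intro b' _ hb'; simp [hb']
  · simp
  · intro b' _ hb'; simp [hb']
  · simp

/-- The fixed subspace of `φ`. -/
def fixedSwap : Submodule F (K10 F) := LinearMap.eqLocus (swap F) LinearMap.id

/-- `F 1 ⊕ (M ⊗ K3)` with `M = F e + F x`. -/
def subM : Submodule F (K10 F) :=
  (⊤ : Submodule F F).prod (Submodule.map₂ (TensorProduct.mk F (K3 F) (K3 F)) (K3.M F) ⊤)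

/-- `F 1 + F (e ⊗ e) + (x ⊗ K3) + (K3 ⊗ y)`. -/
def subXY : Submodule F (K10 F) :=
  (⊤ : Submodule F F).prod
    (Submodule.span F {K3.e F ⊗ₜ[F] K3.e F} ⊔
      Submodule.map₂ (TensorProduct.mk F (K3 F) (K3 F)) (Submodule.span F {K3.x F}) ⊤ ⊔
      Submodule.map₂ (TensorProduct.mk F (K3 F) (K3 F)) ⊤ (Submodule.span F {K3.y F}))

/-- The four subalgebras of the classification. -/
def maxSub : Fin 4 → Submodule F (K10 F) :=
  ![(superalg F).part 0, fixedSwap F, subM F, subXY F]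

end K10

/-! Write the odd part of `K10` as `V ⊕ W` with `V = (Fx + Fy) ⊗ e` and `W = e ⊗ (Fx + Fy)`. An even
element is `r 1 + s (e ⊗ e) + t`, where `t` is a tensor in `(Fx + Fy) ⊗ (Fx + Fy)`. It multiplies an
odd vector by the scalar `r + s/2`, plus half of a map, built from `t` and the symplectic forms,
that exchanges `V` and `W`. A subalgebra containing the even element and the odd vector therefore
contains the exchanged vector as well (`act_mem`). Applying this to a product of two odd elements
gives a triple product on the odd part (`act_mul_mem`). The odd part generates the whole algebra
(`eq_top_of_odd`), so the odd part of a proper subalgebra is proper.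

The group generated by two copies of `SL₂`, acting on `V` and `W`, and by the swap of the factors
consists of automorphisms. It moves every nonzero odd vector to `x ⊗ e` or to `x ⊗ e + e ⊗ x`. A
case analysis on the odd part of a proper subalgebra `B`, starting from such a vector, puts a
translate of `B` inside one of the four subalgebras (`isCovered`). In each case the odd part bounds
the even part, since even elements of `B` must map the odd part of `B` into itself.

A maximal subalgebra that is carried into one of the four is carried onto it
(`IsMaximalSubalg.conjugate`). Conversely each of the four is maximal: for the even part this
follows from `isCovered`, and for the others an extra odd vector would generate the whole odd part.
The even parts of the four have dimensions 6, 3, 4, 5, so no two are conjugate. -/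

namespace K10

/-! ### Coordinates and the multiplication table of `K10`. -/

variable {F : Type*} [Field F]

/-- The coordinates of `K3 ⊗ K3`. -/
def coord (i j : Fin 3) : K3 F ⊗[F] K3 F →ₗ[F] F :=
  (TensorProduct.lid F F).toLinearMap ∘ₗ
    TensorProduct.map (LinearMap.proj i) (LinearMap.proj j)

@[simp] theorem coord_tmul (i j : Fin 3) (a b : K3 F) : coord i j (a ⊗ₜ[F] b) = a i * b j := by
  simp [coord]

theorem coord_ext {u v : K3 F ⊗[F] K3 F} (h : ∀ i j, coord i j u = coord i j v) : u = v := by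
  let β := (Pi.basisFun F (Fin 3)).tensorProduct (Pi.basisFun F (Fin 3))
  have key : ∀ (u : K3 F ⊗[F] K3 F) (i j : Fin 3), β.repr u (i, j) = coord i j u := by
    intro u i j
    induction u using TensorProduct.induction_on with
    | zero => simp
    | add u v hu hv => simp [hu, hv]
    | tmul a b => simp [β, mul_comm]
  apply β.repr.injective
  ext ⟨i, j⟩
  rw [key, key, h]

/-- `r 1 + s (e ⊗ e) + a (x ⊗ x) + b (x ⊗ y) + c (y ⊗ x) + d (y ⊗ y)`. -/
def ev (r s a b c d : F) : K10 F :=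
  (r, s • (K3.e F ⊗ₜ K3.e F) + a • (K3.x F ⊗ₜ K3.x F) + b • (K3.x F ⊗ₜ K3.y F)
    + c • (K3.y F ⊗ₜ K3.x F) + d • (K3.y F ⊗ₜ K3.y F))

/-- `p (x ⊗ e) + q (y ⊗ e) + k (e ⊗ x) + l (e ⊗ y)`. -/
def od (p q k l : F) : K10 F :=
  (0, p • (K3.x F ⊗ₜ K3.e F) + q • (K3.y F ⊗ₜ K3.e F) + k • (K3.e F ⊗ₜ K3.x F)
    + l • (K3.e F ⊗ₜ K3.y F))

theorem forall_coord {P : Fin 3 → Fin 3 → Prop} : (∀ i j, P i j) ↔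
    (P 0 0 ∧ P 0 1 ∧ P 0 2) ∧ (P 1 0 ∧ P 1 1 ∧ P 1 2) ∧ P 2 0 ∧ P 2 1 ∧ P 2 2 := by
  simp [Fin.forall_fin_succ]

theorem ext_coord {z w : K10 F} (h : z.1 = w.1) (h' : ∀ i j, coord i j z.2 = coord i j w.2) :
    z = w := Prod.ext h (coord_ext h')

theorem sum_zmod_two {A : Type*} [AddCommMonoid A] (f : ZMod 2 → A) : ∑ i, f i = f 0 + f 1 :=
  Fin.sum_univ_two f

/-- The sign is `-1` only when the components of `b` and `c` are both odd. Splitting `b` and `c` by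
degree gives a formula without homogeneity hypotheses, which `simp` can apply to basis tensors. -/
theorem tmul_pure (a b c d : K3 F) : tmul F (a ⊗ₜ b) (c ⊗ₜ d) =
    K3.mul F a c ⊗ₜ K3.mul F (K3.proj F 0 b) d +
      (K3.mul F a (K3.proj F 0 c) - K3.mul F a (K3.proj F 1 c)) ⊗ₜ K3.mul F (K3.proj F 1 b) d := by
  nth_rw 2 [← K3.proj_add c]
  simp [tmul, sum_zmod_two, TensorProduct.add_tmul, TensorProduct.sub_tmul, ZMod.val_one]
  abel

theorem tform_pure (a b c d : K3 F) : tform F (a ⊗ₜ b) (c ⊗ₜ d) =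
    K3.form F a c * K3.form F (K3.proj F 0 b) d +
      (K3.form F a (K3.proj F 0 c) - K3.form F a (K3.proj F 1 c)) *
        K3.form F (K3.proj F 1 b) d := by
  nth_rw 2 [← K3.proj_add c]
  simp [tform, sum_zmod_two, ZMod.val_one]
  ring

section
open K3

theorem proj_basis : (proj F 0 (e F) = e F ∧ proj F 1 (e F) = 0) ∧
    (proj F 0 (x F) = 0 ∧ proj F 1 (x F) = x F) ∧
    (proj F 0 (y F) = 0 ∧ proj F 1 (y F) = y F) := by
  refine ⟨⟨?_, ?_⟩, ⟨?_, ?_⟩, ?_, ?_⟩ <;> ext k <;> fin_cases k <;>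
    simp [proj_zero, proj_one, e, x, y]

theorem mul_basis : (K3.mul F (e F) (e F) = e F ∧ K3.mul F (e F) (x F) = (2 : F)⁻¹ • x F ∧
      K3.mul F (e F) (y F) = (2 : F)⁻¹ • y F) ∧
    (K3.mul F (x F) (e F) = (2 : F)⁻¹ • x F ∧ K3.mul F (x F) (x F) = 0 ∧
      K3.mul F (x F) (y F) = e F) ∧
    (K3.mul F (y F) (e F) = (2 : F)⁻¹ • y F ∧ K3.mul F (y F) (x F) = - e F ∧
      K3.mul F (y F) (y F) = 0) := by
  refine ⟨⟨?_, ?_, ?_⟩, ⟨?_, ?_, ?_⟩, ?_, ?_, ?_⟩ <;> ext k <;> fin_cases k <;>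
    simp [K3.mul, e, x, y]

theorem form_basis : (form F (e F) (e F) = (2 : F)⁻¹ ∧ form F (e F) (x F) = 0 ∧
      form F (e F) (y F) = 0) ∧
    (form F (x F) (e F) = 0 ∧ form F (x F) (x F) = 0 ∧ form F (x F) (y F) = 1) ∧
    (form F (y F) (e F) = 0 ∧ form F (y F) (x F) = - 1 ∧ form F (y F) (y F) = 0) := by
  simp [form, e, x, y]

end

theorem mul_apply (z w : K10 F) : mul F z w =
    (z.1 * w.1 - 3 / 4 * tform F z.2 w.2, z.1 • w.2 + w.1 • z.2 + tmul F z.2 w.2) := rfl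

theorem mul_ev_ev (r s a b c d r' s' a' b' c' d' : F) :
    mul F (ev r s a b c d) (ev r' s' a' b' c' d') =
      ev (r * r' - 3 / 4 * (s * s' * 2⁻¹ * 2⁻¹ - (a * d' - b * c' - c * b' + d * a')))
        (r * s' + r' * s + s * s' - (a * d' - b * c' - c * b' + d * a'))
        (r * a' + r' * a + (s * a' + s' * a) * 2⁻¹ * 2⁻¹)
        (r * b' + r' * b + (s * b' + s' * b) * 2⁻¹ * 2⁻¹)
        (r * c' + r' * c + (s * c' + s' * c) * 2⁻¹ * 2⁻¹)
        (r * d' + r' * d + (s * d' + s' * d) * 2⁻¹ * 2⁻¹) := by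
  rw [mul_apply]
  ext1
  · have h : tform F (ev r s a b c d).2 (ev r' s' a' b' c' d').2 =
        s * s' * 2⁻¹ * 2⁻¹ - (a * d' - b * c' - c * b' + d * a') := by
      simp [ev, tform_pure, proj_basis, form_basis]
      ring
    rw [h]
    rfl
  · simp [ev, tmul_pure, proj_basis, mul_basis, ← TensorProduct.smul_tmul',
      TensorProduct.neg_tmul, TensorProduct.tmul_neg]
    module

/-- The coefficients `(p, q)` belong to `V` and `(k, l)` to `W`. Apart from the scalar `r + s/2`,
the new `V` coefficients depend only on `(k, l)` and the new `W` coefficients only on `(p, q)`. -/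
theorem mul_ev_od (r s a b c d p q k l : F) :
    mul F (ev r s a b c d) (od p q k l) =
      od ((r + s * 2⁻¹) * p + (a * l - b * k) * 2⁻¹) ((r + s * 2⁻¹) * q + (c * l - d * k) * 2⁻¹)
        ((r + s * 2⁻¹) * k + (c * p - a * q) * 2⁻¹)
        ((r + s * 2⁻¹) * l + (d * p - b * q) * 2⁻¹) := by
  rw [mul_apply]
  ext1
  · simp [ev, od, tform_pure, proj_basis, form_basis]
  · simp [ev, od, tmul_pure, proj_basis, mul_basis, ← TensorProduct.smul_tmul',
      TensorProduct.neg_tmul, TensorProduct.tmul_neg]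
    module

theorem mul_od_ev (r s a b c d p q k l : F) :
    mul F (od p q k l) (ev r s a b c d) =
      od ((r + s * 2⁻¹) * p + (a * l - b * k) * 2⁻¹) ((r + s * 2⁻¹) * q + (c * l - d * k) * 2⁻¹)
        ((r + s * 2⁻¹) * k + (c * p - a * q) * 2⁻¹)
        ((r + s * 2⁻¹) * l + (d * p - b * q) * 2⁻¹) := by
  rw [mul_apply]
  ext1
  · simp [ev, od, tform_pure, proj_basis, form_basis]
  · simp [ev, od, tmul_pure, proj_basis, mul_basis, ← TensorProduct.smul_tmul',
      TensorProduct.neg_tmul, TensorProduct.tmul_neg]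
    module

/-- The symplectic forms of `V` and `W` contribute a multiple of `e ⊗ e - (3/8) 1`. The cross terms
between `V` and `W` contribute a quarter of a tensor. -/
theorem mul_od_od (p q k l p' q' k' l' : F) :
    mul F (od p q k l) (od p' q' k' l') =
      ev (-(3 / 4 * 2⁻¹ * (p * q' - q * p' + k * l' - l * k')))
        (p * q' - q * p' + k * l' - l * k')
        ((p * k' - p' * k) * 2⁻¹ * 2⁻¹) ((p * l' - p' * l) * 2⁻¹ * 2⁻¹)
        ((q * k' - q' * k) * 2⁻¹ * 2⁻¹) ((q * l' - q' * l) * 2⁻¹ * 2⁻¹) := by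
  rw [mul_apply]
  ext1
  · have h : tform F (od p q k l).2 (od p' q' k' l').2 =
        2⁻¹ * (p * q' - q * p' + k * l' - l * k') := by
      simp [od, tform_pure, proj_basis, form_basis]
      ring
    rw [h]
    simp only [od, ev]
    ring
  · simp [ev, od, tmul_pure, proj_basis, mul_basis, ← TensorProduct.smul_tmul',
      TensorProduct.neg_tmul, TensorProduct.tmul_neg]
    module

theorem basis_mem_part : K3.e F ∈ K3.part F 0 ∧ K3.x F ∈ K3.part F 1 ∧ K3.y F ∈ K3.part F 1 :=
  ⟨K3.mem_part_zero.2 (by simp [K3.e]), K3.mem_part_one.2 (by simp [K3.x]),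
    K3.mem_part_one.2 (by simp [K3.y])⟩

theorem ev_mem_part (r s a b c d : F) : ev r s a b c d ∈ part F 0 := by
  obtain ⟨he, hx, hy⟩ := basis_mem_part (F := F)
  have h0 : K3.e F ⊗ₜ[F] K3.e F ∈ tpart F 0 := by
    have := tmul_mem_tpart he he
    rwa [add_zero] at this
  have h {u v : K3 F} (hu : u ∈ K3.part F 1) (hv : v ∈ K3.part F 1) :
      u ⊗ₜ[F] v ∈ tpart F 0 := by
    have := tmul_mem_tpart hu hv
    rwa [CharTwo.add_self_eq_zero] at this
  refine Submodule.mem_prod.2 ⟨by simp, ?_⟩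
  have hs {t : F} {u : K3 F ⊗[F] K3 F} (hu : u ∈ tpart F 0) : t • u ∈ tpart F 0 :=
    Submodule.smul_mem _ _ hu
  exact add_mem (add_mem (add_mem (add_mem (hs h0) (hs (h hx hx))) (hs (h hx hy)))
    (hs (h hy hx))) (hs (h hy hy))

theorem od_mem_part (p q k l : F) : od p q k l ∈ part F 1 := by
  obtain ⟨he, hx, hy⟩ := basis_mem_part (F := F)
  have h {u : K3 F} (hu : u ∈ K3.part F 1) :
      u ⊗ₜ[F] K3.e F ∈ tpart F 1 ∧ K3.e F ⊗ₜ[F] u ∈ tpart F 1 := by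
    have h1 := tmul_mem_tpart hu he
    have h2 := tmul_mem_tpart he hu
    rw [add_zero] at h1
    rw [zero_add] at h2
    exact ⟨h1, h2⟩
  refine Submodule.mem_prod.2 ⟨by simp [od], ?_⟩
  have hs {t : F} {u : K3 F ⊗[F] K3 F} (hu : u ∈ tpart F 1) : t • u ∈ tpart F 1 :=
    Submodule.smul_mem _ _ hu
  exact add_mem (add_mem (add_mem (hs (h hx).1) (hs (h hy).1)) (hs (h hx).2)) (hs (h hy).2)

theorem eq_ev_add_od (z : K10 F) : z = ev z.1 (coord 0 0 z.2) (coord 1 1 z.2) (coord 1 2 z.2)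
    (coord 2 1 z.2) (coord 2 2 z.2) +
      od (coord 1 0 z.2) (coord 2 0 z.2) (coord 0 1 z.2) (coord 0 2 z.2) := by
  refine ext_coord (by simp [ev, od]) ?_
  rw [forall_coord]
  simp [ev, od, K3.e, K3.x, K3.y]

theorem exists_ev_add_od (z : K10 F) : ∃ r s a b c d p q k l : F,
    z = ev r s a b c d + od p q k l :=
  ⟨_, _, _, _, _, _, _, _, _, _, eq_ev_add_od z⟩

theorem mem_part_zero {z : K10 F} : z ∈ part F 0 ↔ ∃ r s a b c d : F, z = ev r s a b c d := by
  constructor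
  · intro hz
    obtain ⟨r, s, a, b, c, d, p, q, k, l, rfl⟩ := exists_ev_add_od z
    have h : od p q k l ∈ part F 0 := ((part F 0).add_mem_iff_right (ev_mem_part ..)).1 hz
    have := (Submodule.disjoint_def.1 (isCompl_part F).disjoint) _ h (od_mem_part ..)
    exact ⟨r, s, a, b, c, d, by rw [this, add_zero]⟩
  · rintro ⟨r, s, a, b, c, d, rfl⟩
    exact ev_mem_part ..

theorem mem_part_one {z : K10 F} : z ∈ part F 1 ↔ ∃ p q k l : F, z = od p q k l := by
  constructor
  · intro hz
    obtain ⟨r, s, a, b, c, d, p, q, k, l, rfl⟩ := exists_ev_add_od z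
    have h : ev r s a b c d ∈ part F 1 := ((part F 1).add_mem_iff_left (od_mem_part ..)).1 hz
    have := (Submodule.disjoint_def.1 (isCompl_part F).disjoint) _ (ev_mem_part ..) h
    exact ⟨p, q, k, l, by rw [this, zero_add]⟩
  · rintro ⟨p, q, k, l, rfl⟩
    exact od_mem_part ..

theorem ev_inj {r s a b c d r' s' a' b' c' d' : F} : ev r s a b c d = ev r' s' a' b' c' d' ↔
    r = r' ∧ s = s' ∧ a = a' ∧ b = b' ∧ c = c' ∧ d = d' := by
  constructor
  · intro h
    have h1 := congrArg Prod.fst h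
    have h2 (i j : Fin 3) := congrArg (fun z => coord i j z.2) h
    rw [forall_coord] at h2
    simp [ev, K3.e, K3.x, K3.y] at h1 h2
    exact ⟨h1, h2.1, h2.2.1.1, h2.2.1.2, h2.2.2.1, h2.2.2.2⟩
  · rintro ⟨rfl, rfl, rfl, rfl, rfl, rfl⟩
    rfl

theorem od_inj {p q k l p' q' k' l' : F} : od p q k l = od p' q' k' l' ↔
    p = p' ∧ q = q' ∧ k = k' ∧ l = l' := by
  constructor
  · intro h
    have h2 (i j : Fin 3) := congrArg (fun z => coord i j z.2) h
    rw [forall_coord] at h2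
    simp [od, K3.e, K3.x, K3.y] at h2
    exact ⟨h2.2.1, h2.2.2, h2.1.1, h2.1.2⟩
  · rintro ⟨rfl, rfl, rfl, rfl⟩
    rfl

theorem ev_add (r s a b c d r' s' a' b' c' d' : F) :
    ev r s a b c d + ev r' s' a' b' c' d' =
      ev (r + r') (s + s') (a + a') (b + b') (c + c') (d + d') := by
  ext1
  · simp [ev]
  · simp only [ev, Prod.snd_add]; module

theorem smul_ev (t r s a b c d : F) :
    t • ev r s a b c d = ev (t * r) (t * s) (t * a) (t * b) (t * c) (t * d) := by
  ext1
  · simp [ev]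
  · simp only [ev, Prod.smul_snd]; module

theorem od_add (p q k l p' q' k' l' : F) :
    od p q k l + od p' q' k' l' = od (p + p') (q + q') (k + k') (l + l') := by
  ext1
  · simp [od]
  · simp only [od, Prod.snd_add]; module

theorem smul_od (t p q k l : F) : t • od p q k l = od (t * p) (t * q) (t * k) (t * l) := by
  ext1
  · simp [od]
  · simp only [od, Prod.smul_snd]; module

theorem od_zero : od (0 : F) 0 0 0 = 0 := by simp [od]

theorem ev_zero : ev (0 : F) 0 0 0 0 0 = 0 := by simp [ev]

theorem swap_ev (r s a b c d : F) :
    swap F (ev r s a b c d) = ev r s (-a) (-c) (-b) (-d) := by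
  ext1
  · simp [swap, ev]
  · simp [swap, ev, tswap, sum_zmod_two, proj_basis, ZMod.val_one]
    module

theorem swap_od (p q k l : F) : swap F (od p q k l) = od k l p q := by
  ext1
  · simp [swap, od]
  · simp [swap, od, tswap, sum_zmod_two, proj_basis, ZMod.val_one]
    module

end K10

/-! ### Automorphisms, conjugacy and subconjugacy in a general superalgebra. -/

namespace Superalg

variable {F A : Type*} [Field F] [AddCommGroup A] [Module F A] {S : Superalg F A}

theorem IsAut.refl : S.IsAut (LinearEquiv.refl F A) :=
  ⟨fun _ _ => rfl, fun _ => Submodule.map_id _⟩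

theorem IsAut.trans {g h : A ≃ₗ[F] A} (hg : S.IsAut g) (hh : S.IsAut h) :
    S.IsAut (g.trans h) := by
  refine ⟨fun a b => by simp [hg.map_mul, hh.map_mul], fun i => ?_⟩
  rw [LinearEquiv.coe_trans, Submodule.map_comp, hg.map_part, hh.map_part]

theorem IsAut.symm {g : A ≃ₗ[F] A} (hg : S.IsAut g) : S.IsAut g.symm := by
  refine ⟨fun a b => ?_, fun i => ?_⟩
  · apply g.injective
    simp [hg.map_mul]
  · conv_lhs => rw [← hg.map_part i]
    rw [← Submodule.map_comp]
    simp

theorem map_symm_map (g : A ≃ₗ[F] A) (B : Submodule F A) :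
    (B.map (g : A →ₗ[F] A)).map (g.symm : A →ₗ[F] A) = B := by
  rw [← Submodule.map_comp]
  simp

theorem map_map_symm (g : A ≃ₗ[F] A) (B : Submodule F A) :
    (B.map (g.symm : A →ₗ[F] A)).map (g : A →ₗ[F] A) = B :=
  map_symm_map g.symm B

theorem IsSubalg.map {B : Submodule F A} (hB : S.IsSubalg B) {g : A ≃ₗ[F] A} (hg : S.IsAut g) :
    S.IsSubalg (B.map (g : A →ₗ[F] A)) := by
  constructor
  · rintro _ ⟨a, ha, rfl⟩ _ ⟨b, hb, rfl⟩
    exact ⟨S.mul a b, hB.mul_mem a ha b hb, hg.map_mul a b⟩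
  · have h (i : ZMod 2) : (B ⊓ S.part i).map (g : A →ₗ[F] A) =
        B.map (g : A →ₗ[F] A) ⊓ S.part i := by
      rw [Submodule.map_inf _ g.injective, hg.map_part]
    conv_lhs => rw [hB.graded]
    rw [Submodule.map_sup, h, h]

theorem map_ne_top {B : Submodule F A} (hB : B ≠ ⊤) (g : A ≃ₗ[F] A) :
    B.map (g : A →ₗ[F] A) ≠ ⊤ := by
  intro h
  apply hB
  rw [← map_symm_map g B, h, Submodule.map_top, LinearEquiv.range]

theorem IsMaximalSubalg.map {B : Submodule F A} (hB : S.IsMaximalSubalg B) {g : A ≃ₗ[F] A}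
    (hg : S.IsAut g) : S.IsMaximalSubalg (B.map (g : A →ₗ[F] A)) := by
  refine ⟨⟨hB.1.1.map hg, map_ne_top hB.1.2 g⟩, fun C hC hBC => ?_⟩
  have h := hB.2 (y := C.map (g.symm : A →ₗ[F] A)) ⟨hC.1.map hg.symm, map_ne_top hC.2 _⟩ (by
    rw [← map_symm_map g B]
    exact Submodule.map_mono hBC)
  rw [← map_map_symm g C]
  exact Submodule.map_mono h

theorem Conjugate.symm {B C : Submodule F A} (h : S.Conjugate B C) : S.Conjugate C B := by
  obtain ⟨g, hg, rfl⟩ := h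
  exact ⟨g.symm, hg.symm, map_symm_map g B⟩

theorem Conjugate.isMaximalSubalg {B C : Submodule F A} (h : S.Conjugate B C)
    (hC : S.IsMaximalSubalg C) : S.IsMaximalSubalg B := by
  obtain ⟨g, hg, rfl⟩ := h.symm
  exact hC.map hg

/-- Automorphisms preserve the grading, so these dimensions are invariants of a conjugacy class. -/
theorem Conjugate.finrank_inf_part {B C : Submodule F A} (h : S.Conjugate B C) (i : ZMod 2) :
    Module.finrank F ↥(B ⊓ S.part i) = Module.finrank F ↥(C ⊓ S.part i) := by
  obtain ⟨g, hg, rfl⟩ := h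
  rw [← LinearEquiv.finrank_map_eq g (B ⊓ S.part i), Submodule.map_inf _ g.injective, hg.map_part]

/-- `B` is carried into `C` by some automorphism. -/
def Subconjugate (S : Superalg F A) (B C : Submodule F A) : Prop :=
  ∃ g : A ≃ₗ[F] A, S.IsAut g ∧ B.map (g : A →ₗ[F] A) ≤ C

theorem Subconjugate.of_le {B C : Submodule F A} (h : B ≤ C) : S.Subconjugate B C :=
  ⟨_, IsAut.refl, by simpa using h⟩

theorem Subconjugate.of_map {B C : Submodule F A} {g : A ≃ₗ[F] A} (hg : S.IsAut g)
    (h : S.Subconjugate (B.map (g : A →ₗ[F] A)) C) : S.Subconjugate B C := by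
  obtain ⟨g', hg', h'⟩ := h
  refine ⟨g.trans g', hg.trans hg', ?_⟩
  rwa [LinearEquiv.coe_trans, Submodule.map_comp]

/-- The image of `B` is again maximal, so inclusion in a proper subalgebra forces equality. -/
theorem IsMaximalSubalg.conjugate {B C : Submodule F A} (hB : S.IsMaximalSubalg B)
    (hC : S.IsSubalg C) (hC' : C ≠ ⊤) (h : S.Subconjugate B C) : S.Conjugate B C := by
  obtain ⟨g, hg, hBC⟩ := h
  exact ⟨g, hg, hBC.antisymm ((hB.map hg).2 ⟨hC, hC'⟩ hBC)⟩

end Superalg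

/-! ### The swap and the two actions of `SL₂` as automorphisms. -/

namespace K10

variable {F : Type*} [Field F]

theorem isAut_of_homogeneous {g : K10 F ≃ₗ[F] K10 F} (hp : ∀ i, ∀ z ∈ part F i, g z ∈ part F i)
    (hp' : ∀ i, ∀ z ∈ part F i, g.symm z ∈ part F i)
    (hm : ∀ i j, ∀ z ∈ part F i, ∀ w ∈ part F j, g (mul F z w) = mul F (g z) (g w)) :
    (superalg F).IsAut g := by
  constructor
  · intro z w
    obtain ⟨r, s, a, b, c, d, p, q, k, l, rfl⟩ := exists_ev_add_od z
    obtain ⟨r', s', a', b', c', d', p', q', k', l', rfl⟩ := exists_ev_add_od w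
    change g (mul F _ _) = mul F _ _
    simp only [map_add, LinearMap.add_apply, hm 0 0 _ (ev_mem_part ..) _ (ev_mem_part ..),
      hm 0 1 _ (ev_mem_part ..) _ (od_mem_part ..), hm 1 0 _ (od_mem_part ..) _ (ev_mem_part ..),
      hm 1 1 _ (od_mem_part ..) _ (od_mem_part ..)]
  · intro i
    refine le_antisymm ?_ fun z hz => ⟨g.symm z, hp' i z hz, by simp⟩
    rintro _ ⟨z, hz, rfl⟩
    exact hp i z hz

theorem forall_part {P : ZMod 2 → K10 F → Prop} : (∀ i, ∀ z ∈ part F i, P i z) ↔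
    (∀ r s a b c d, P 0 (ev r s a b c d)) ∧ ∀ p q k l, P 1 (od p q k l) := by
  constructor
  · exact fun h => ⟨fun _ _ _ _ _ _ => h 0 _ (ev_mem_part ..), fun _ _ _ _ => h 1 _ (od_mem_part ..)⟩
  · rintro ⟨h0, h1⟩ i z hz
    obtain rfl | rfl := K3.eq_zero_or_one i
    · obtain ⟨r, s, a, b, c, d, rfl⟩ := mem_part_zero.1 hz
      exact h0 ..
    · obtain ⟨p, q, k, l, rfl⟩ := mem_part_one.1 hz
      exact h1 ..

theorem swap_swap (z : K10 F) : swap F (swap F z) = z := by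
  obtain ⟨r, s, a, b, c, d, p, q, k, l, rfl⟩ := exists_ev_add_od z
  simp [swap_ev, swap_od]

variable (F) in
/-- The swap as a linear automorphism. -/
def swapEquiv : K10 F ≃ₗ[F] K10 F :=
  LinearEquiv.ofInvolutive (swap F) swap_swap

theorem swapEquiv_apply (z : K10 F) : swapEquiv F z = swap F z := rfl

theorem swapEquiv_isAut : (superalg F).IsAut (swapEquiv F) := by
  have hp : ∀ i, ∀ z ∈ part F i, swap F z ∈ part F i := by
    rw [forall_part]
    exact ⟨fun _ _ _ _ _ _ => by rw [swap_ev]; exact ev_mem_part .., fun _ _ _ _ => by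
      rw [swap_od]; exact od_mem_part ..⟩
  refine isAut_of_homogeneous hp hp ?_
  intro i j z hz w hw
  revert i z
  rw [forall_part]
  revert j w
  -- The predicate on `w` is now itself a pair of quantified statements, so its shape is given
  -- explicitly.
  rw [forall_part (P := fun j w => (∀ r s a b c d, _) ∧ ∀ p q k l, _)]
  simp only [swapEquiv_apply, mul_ev_ev, mul_ev_od, mul_od_ev, mul_od_od, swap_ev, swap_od,
    ev_inj, od_inj]
  refine ⟨fun _ _ _ _ _ _ => ⟨fun _ _ _ _ _ _ => ?_, fun _ _ _ _ => ?_⟩,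
    fun _ _ _ _ => ⟨fun _ _ _ _ _ _ => ?_, fun _ _ _ _ => ?_⟩⟩ <;>
  refine ⟨?_, ?_, ?_, ?_⟩ <;> (try refine ⟨?_, ?_, ?_⟩) <;> ring

/-- The endomorphism of `K3` which fixes `e` and has matrix `!![α, β; γ, δ]` on `F x + F y`. -/
def oddMap (α β γ δ : F) : K3 F →ₗ[F] K3 F where
  toFun a := ![a 0, α * a 1 + β * a 2, γ * a 1 + δ * a 2]
  map_add' a b := by ext k; fin_cases k <;> simp <;> ring
  map_smul' t a := by ext k; fin_cases k <;> simp <;> ring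

theorem oddMap_basis (α β γ δ : F) : oddMap α β γ δ (K3.e F) = K3.e F ∧
    oddMap α β γ δ (K3.x F) = α • K3.x F + γ • K3.y F ∧
    oddMap α β γ δ (K3.y F) = β • K3.x F + δ • K3.y F := by
  refine ⟨?_, ?_, ?_⟩ <;> ext k <;> fin_cases k <;> simp [oddMap, K3.e, K3.x, K3.y]

/-- The action of `oddMap` on the first tensor factor. -/
def leftMap (α β γ δ : F) : K10 F →ₗ[F] K10 F :=
  LinearMap.id.prodMap (TensorProduct.map (oddMap α β γ δ) LinearMap.id)

theorem leftMap_ev (α β γ δ r s a b c d : F) : leftMap α β γ δ (ev r s a b c d) =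
    ev r s (α * a + β * c) (α * b + β * d) (γ * a + δ * c) (γ * b + δ * d) := by
  ext1
  · simp [leftMap, ev]
  · simp [leftMap, ev, oddMap_basis, TensorProduct.add_tmul, ← TensorProduct.smul_tmul']
    module

theorem leftMap_od (α β γ δ p q k l : F) : leftMap α β γ δ (od p q k l) =
    od (α * p + β * q) (γ * p + δ * q) k l := by
  ext1
  · simp [leftMap, od]
  · simp [leftMap, od, oddMap_basis, TensorProduct.add_tmul, ← TensorProduct.smul_tmul']
    module

theorem leftMap_leftMap {α β γ δ : F} (h : α * δ - β * γ = 1) (z : K10 F) :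
    leftMap δ (-β) (-γ) α (leftMap α β γ δ z) = z := by
  obtain ⟨r, s, a, b, c, d, p, q, k, l, rfl⟩ := exists_ev_add_od z
  simp only [map_add, leftMap_ev, leftMap_od]
  congr 1
  · rw [ev_inj]
    refine ⟨rfl, rfl, ?_, ?_, ?_, ?_⟩
    · linear_combination a * h
    · linear_combination b * h
    · linear_combination c * h
    · linear_combination d * h
  · rw [od_inj]
    refine ⟨?_, ?_, rfl, rfl⟩
    · linear_combination p * h
    · linear_combination q * h

/-- The action of `SL₂` on the first tensor factor. -/
def leftEquiv {α β γ δ : F} (h : α * δ - β * γ = 1) : K10 F ≃ₗ[F] K10 F :=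
  LinearEquiv.ofLinearMap (leftMap α β γ δ) (leftMap δ (-β) (-γ) α)
    (LinearMap.ext fun z => by
      simpa using leftMap_leftMap (α := δ) (β := -β) (γ := -γ) (δ := α)
        (by linear_combination h) z)
    (LinearMap.ext fun z => leftMap_leftMap h z)

/-- The odd-odd product and the odd part of the form on `K3` are both multiples of the determinant
form on `Fx + Fy`, so determinant one is what makes the map multiplicative. -/
theorem leftEquiv_isAut {α β γ δ : F} (h : α * δ - β * γ = 1) :
    (superalg F).IsAut (leftEquiv h) := by
  have hp (α β γ δ : F) : ∀ i, ∀ z ∈ part F i, leftMap α β γ δ z ∈ part F i := by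
    rw [forall_part]
    exact ⟨fun _ _ _ _ _ _ => by rw [leftMap_ev]; exact ev_mem_part .., fun _ _ _ _ => by
      rw [leftMap_od]; exact od_mem_part ..⟩
  refine isAut_of_homogeneous (hp α β γ δ) (hp δ (-β) (-γ) α) ?_
  intro i j z hz w hw
  change leftMap α β γ δ _ = mul F (leftMap α β γ δ _) (leftMap α β γ δ _)
  revert i z
  rw [forall_part]
  revert j w
  rw [forall_part (P := fun j w => (∀ r s a b c d, _) ∧ ∀ p q k l, _)]
  simp only [mul_ev_ev, mul_ev_od, mul_od_ev, mul_od_od, leftMap_ev, leftMap_od, ev_inj, od_inj]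
  refine ⟨fun r s a b c d => ⟨fun r' s' a' b' c' d' => ?_, fun p q k l => ?_⟩,
    fun p q k l => ⟨fun r' s' a' b' c' d' => ?_, fun p' q' k' l' => ?_⟩⟩
  · refine ⟨?_, ?_, ?_, ?_, ?_, ?_⟩
    · linear_combination -(3 / 4 * (a * d' - b * c' - c * b' + d * a')) * h
    · linear_combination (a * d' - b * c' - c * b' + d * a') * h
    all_goals ring
  · refine ⟨?_, ?_, ?_, ?_⟩
    · ring
    · ring
    · linear_combination (-(c * p - a * q) * 2⁻¹) * h
    · linear_combination (-(d * p - b * q) * 2⁻¹) * h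
  · refine ⟨?_, ?_, ?_, ?_⟩
    · ring
    · ring
    · linear_combination (-(c' * p - a' * q) * 2⁻¹) * h
    · linear_combination (-(d' * p - b' * q) * 2⁻¹) * h
  · refine ⟨?_, ?_, ?_, ?_, ?_, ?_⟩
    · linear_combination -(3 / 4 * 2⁻¹ * (p * q' - q * p')) * h
    · linear_combination (p * q' - q * p') * h
    all_goals ring

theorem leftEquiv_od {α β γ δ : F} (h : α * δ - β * γ = 1) (p q k l : F) :
    leftEquiv h (od p q k l) = od (α * p + β * q) (γ * p + δ * q) k l :=
  leftMap_od ..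

/-- The action of `SL₂` on the second tensor factor. -/
def rightEquiv {α β γ δ : F} (h : α * δ - β * γ = 1) : K10 F ≃ₗ[F] K10 F :=
  ((swapEquiv F).trans (leftEquiv h)).trans (swapEquiv F)

theorem rightEquiv_isAut {α β γ δ : F} (h : α * δ - β * γ = 1) :
    (superalg F).IsAut (rightEquiv h) :=
  (swapEquiv_isAut.trans (leftEquiv_isAut h)).trans swapEquiv_isAut

theorem rightEquiv_od {α β γ δ : F} (h : α * δ - β * γ = 1) (p q k l : F) :
    rightEquiv h (od p q k l) = od p q (α * k + β * l) (γ * k + δ * l) := by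
  simp [rightEquiv, swapEquiv_apply, swap_od, leftEquiv_od]

/-! ### The four subalgebras in coordinates. -/

theorem mem_fixedSwap (h2 : (2 : F) ≠ 0) (r s a b c d p q k l : F) :
    ev r s a b c d + od p q k l ∈ fixedSwap F ↔
      (a = 0 ∧ c = -b ∧ d = 0) ∧ k = p ∧ l = q := by
  have h (u v : K10 F) (hu : u ∈ part F 0) (hv : v ∈ part F 1) (hv' : swap F v ∈ part F 1)
      (hu' : swap F u ∈ part F 0) :
      swap F (u + v) = u + v ↔ swap F u = u ∧ swap F v = v := by
    refine ⟨fun h => ?_, fun h => by rw [map_add, h.1, h.2]⟩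
    -- The left side is even and the right side is odd, so both vanish.
    have h1 : swap F u - u = v - swap F v := by
      rw [map_add] at h
      rw [sub_eq_sub_iff_add_eq_add, h, add_comm]
    have h3 := (Submodule.disjoint_def.1 (isCompl_part F).disjoint) _ (sub_mem hu' hu)
      (h1 ▸ sub_mem hv hv')
    exact ⟨sub_eq_zero.1 h3, (sub_eq_zero.1 (h1 ▸ h3)).symm⟩
  rw [fixedSwap, LinearMap.mem_eqLocus, LinearMap.id_apply, h _ _ (ev_mem_part ..)
    (od_mem_part ..) (by rw [swap_od]; exact od_mem_part ..)
    (by rw [swap_ev]; exact ev_mem_part ..), swap_ev, swap_od, ev_inj, od_inj]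
  have hneg (t : F) : -t = t ↔ t = 0 := by
    refine ⟨fun ht => ?_, fun ht => by rw [ht, neg_zero]⟩
    have : 2 * t = 0 := by linear_combination -ht
    exact (mul_eq_zero.1 this).resolve_left h2
  rw [hneg, hneg]
  constructor
  · rintro ⟨⟨-, -, ha, hb, -, hd⟩, hp, hq, -⟩
    exact ⟨⟨ha, by rw [← hb, neg_neg], hd⟩, hp, hq⟩
  · rintro ⟨⟨rfl, rfl, rfl⟩, rfl, rfl⟩
    simp

theorem mem_subM (r s a b c d p q k l : F) :
    ev r s a b c d + od p q k l ∈ subM F ↔ c = 0 ∧ d = 0 ∧ q = 0 := by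
  have he : K3.e F ∈ K3.M F := Submodule.subset_span (by simp)
  have hx : K3.x F ∈ K3.M F := Submodule.subset_span (by simp)
  have hm {u v : K3 F} (t : F) (hu : u ∈ K3.M F) : t • u ⊗ₜ[F] v ∈
      Submodule.map₂ (TensorProduct.mk F (K3 F) (K3 F)) (K3.M F) ⊤ :=
    Submodule.smul_mem _ _ (Submodule.apply_mem_map₂ (TensorProduct.mk F _ _) hu trivial)
  have hle (j : Fin 3) : Submodule.map₂ (TensorProduct.mk F (K3 F) (K3 F)) (K3.M F) ⊤ ≤
      LinearMap.ker (coord 2 j) := by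
    refine Submodule.map₂_le.2 fun u hu v _ => ?_
    obtain ⟨t, t', rfl⟩ := Submodule.mem_span_pair.1 hu
    simp [K3.e, K3.x]
  constructor
  · intro h
    have h' (j : Fin 3) := hle j (Submodule.mem_prod.1 h).2
    have h0 := h' 0
    have h1 := h' 1
    have h2 := h' 2
    simp [ev, od, K3.e, K3.x, K3.y] at h0 h1 h2
    exact ⟨h1, h2, h0⟩
  · rintro ⟨rfl, rfl, rfl⟩
    refine Submodule.mem_prod.2 ⟨trivial, ?_⟩
    simp only [ev, od, Prod.snd_add, zero_smul, add_zero]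
    exact add_mem (add_mem (add_mem (hm _ he) (hm _ hx)) (hm _ hx))
      (add_mem (add_mem (hm _ hx) (hm _ he)) (hm _ he))

theorem mem_subXY (r s a b c d p q k l : F) :
    ev r s a b c d + od p q k l ∈ subXY F ↔ c = 0 ∧ q = 0 ∧ k = 0 := by
  set P := Submodule.span F {K3.e F ⊗ₜ[F] K3.e F} with hP
  set X := Submodule.map₂ (TensorProduct.mk F (K3 F) (K3 F)) (Submodule.span F {K3.x F}) ⊤ with hX
  set Y := Submodule.map₂ (TensorProduct.mk F (K3 F) (K3 F)) ⊤ (Submodule.span F {K3.y F}) with hY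
  have he (t : F) : t • K3.e F ⊗ₜ[F] K3.e F ∈ P ⊔ X ⊔ Y :=
    Submodule.mem_sup_left (Submodule.mem_sup_left
      (Submodule.smul_mem _ _ (Submodule.mem_span_singleton_self _)))
  have hx (v : K3 F) (t : F) : t • K3.x F ⊗ₜ[F] v ∈ P ⊔ X ⊔ Y :=
    Submodule.mem_sup_left (Submodule.mem_sup_right (Submodule.smul_mem _ _
      (Submodule.apply_mem_map₂ (TensorProduct.mk F _ _) (Submodule.mem_span_singleton_self _)
        trivial)))
  have hy (v : K3 F) (t : F) : t • v ⊗ₜ[F] K3.y F ∈ P ⊔ X ⊔ Y :=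
    Submodule.mem_sup_right (Submodule.smul_mem _ _
      (Submodule.apply_mem_map₂ (TensorProduct.mk F _ _) trivial
        (Submodule.mem_span_singleton_self _)))
  have hle : P ⊔ X ⊔ Y ≤ LinearMap.ker (coord 2 0) ⊓ LinearMap.ker (coord 2 1) ⊓
      LinearMap.ker (coord 0 1) := by
    refine sup_le (sup_le ?_ ?_) ?_
    · rw [hP, Submodule.span_singleton_le_iff_mem]
      simp [K3.e]
    · refine Submodule.map₂_le.2 fun u hu v _ => ?_
      obtain ⟨t, rfl⟩ := Submodule.mem_span_singleton.1 hu
      simp [K3.x]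
    · refine Submodule.map₂_le.2 fun u _ v hv => ?_
      obtain ⟨t, rfl⟩ := Submodule.mem_span_singleton.1 hv
      simp [K3.y]
  constructor
  · intro h
    obtain ⟨⟨h0, h1⟩, h2⟩ := hle (Submodule.mem_prod.1 h).2
    simp [ev, od, K3.e, K3.x, K3.y] at h0 h1 h2
    exact ⟨h1, h0, h2⟩
  · rintro ⟨rfl, rfl, rfl⟩
    refine Submodule.mem_prod.2 ⟨trivial, ?_⟩
    simp only [ev, od, Prod.snd_add, zero_smul, add_zero]
    exact add_mem (add_mem (add_mem (add_mem (he _) (hx _ _)) (hx _ _)) (hy _ _))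
      (add_mem (hx _ _) (hy _ _))

theorem mem_even (r s a b c d p q k l : F) :
    ev r s a b c d + od p q k l ∈ part F 0 ↔ p = 0 ∧ q = 0 ∧ k = 0 ∧ l = 0 := by
  rw [(part F 0).add_mem_iff_right (ev_mem_part ..), ← od_inj (p := p), od_zero]
  refine ⟨fun h => ?_, fun h => by rw [h]; exact zero_mem _⟩
  exact (Submodule.disjoint_def.1 (isCompl_part F).disjoint) _ h (od_mem_part ..)

end K10

/-! ### Closure properties of a subalgebra and generation by the odd part. -/

namespace K10

variable {F : Type*} [Field F] {B : Submodule F (K10 F)}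

theorem ev_mem_of_eq {r s a b c d r' s' a' b' c' d' : F} (h : ev r s a b c d ∈ B) (hr : r = r')
    (hs : s = s') (ha : a = a') (hb : b = b') (hc : c = c') (hd : d = d') :
    ev r' s' a' b' c' d' ∈ B := by
  subst hr hs ha hb hc hd
  exact h

theorem od_mem_of_eq {p q k l p' q' k' l' : F} (h : od p q k l ∈ B) (hp : p = p') (hq : q = q')
    (hk : k = k') (hl : l = l') : od p' q' k' l' ∈ B := by
  subst hp hq hk hl
  exact h

theorem od_comb_mem (t t' : F) {p q k l p' q' k' l' : F} (h : od p q k l ∈ B)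
    (h' : od p' q' k' l' ∈ B) :
    od (t * p + t' * p') (t * q + t' * q') (t * k + t' * k') (t * l + t' * l') ∈ B := by
  have := B.add_mem (B.smul_mem t h) (B.smul_mem t' h')
  rwa [smul_od, smul_od, od_add] at this

theorem od_div_mem (t : F) {p q k l : F} (h : od p q k l ∈ B) :
    od (p / t) (q / t) (k / t) (l / t) ∈ B := by
  have := B.smul_mem t⁻¹ h
  rw [smul_od] at this
  exact od_mem_of_eq this (by ring) (by ring) (by ring) (by ring)

theorem ev_div_mem (t : F) {r s a b c d : F} (h : ev r s a b c d ∈ B) :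
    ev (r / t) (s / t) (a / t) (b / t) (c / t) (d / t) ∈ B := by
  have := B.smul_mem t⁻¹ h
  rw [smul_ev] at this
  exact ev_mem_of_eq this (by ring) (by ring) (by ring) (by ring) (by ring) (by ring)

theorem split_mem (hB : (superalg F).IsSubalg B) {r s a b c d p q k l : F}
    (h : ev r s a b c d + od p q k l ∈ B) : ev r s a b c d ∈ B ∧ od p q k l ∈ B := by
  rw [hB.graded] at h
  obtain ⟨u, hu, v, hv, huv⟩ := Submodule.mem_sup.1 h
  obtain ⟨r', s', a', b', c', d', rfl⟩ := mem_part_zero.1 hu.2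
  obtain ⟨p', q', k', l', rfl⟩ := mem_part_one.1 hv.2
  have h1 : ev r' s' a' b' c' d' - ev r s a b c d = od p q k l - od p' q' k' l' := by
    rw [sub_eq_sub_iff_add_eq_add, huv, add_comm]
  have h2 := (Submodule.disjoint_def.1 (isCompl_part F).disjoint) _
    (sub_mem (ev_mem_part ..) (ev_mem_part ..)) (h1 ▸ sub_mem (od_mem_part ..) (od_mem_part ..))
  have h3 := sub_eq_zero.1 h2
  have h4 := sub_eq_zero.1 (h1 ▸ h2)
  rw [← h3, h4]
  exact ⟨hu.1, hv.1⟩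

theorem le_of_homogeneous (hB : (superalg F).IsSubalg B) {C : Submodule F (K10 F)}
    (h : ∀ r s a b c d p q k l, ev r s a b c d ∈ B → od p q k l ∈ B →
      ev r s a b c d + od p q k l ∈ C) : B ≤ C := by
  intro z hz
  obtain ⟨r, s, a, b, c, d, p, q, k, l, rfl⟩ := exists_ev_add_od z
  exact h _ _ _ _ _ _ _ _ _ _ (split_mem hB hz).1 (split_mem hB hz).2

/-- The scalar part of the action keeps the odd vector in `B`, so it can be subtracted. What remains
depends only on the tensor coefficients `a, b, c, d`, even if the tensor alone is not in `B`. -/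
theorem act_mem (hB : (superalg F).IsSubalg B) (h2 : (2 : F) ≠ 0) {r s a b c d p q k l : F}
    (h : ev r s a b c d ∈ B) (h' : od p q k l ∈ B) :
    od (a * l - b * k) (c * l - d * k) (c * p - a * q) (d * p - b * q) ∈ B := by
  have h1 := hB.mul_mem _ h _ h'
  change mul F _ _ ∈ B at h1
  rw [mul_ev_od] at h1
  refine od_mem_of_eq (od_comb_mem 2 (-2 * (r + s * 2⁻¹)) h1 h') ?_ ?_ ?_ ?_ <;>
  · field_simp
    ring

/-- This is `act_mem` for the product of the first two vectors acting on the third. The factor 4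
clears the quarters in `mul_od_od`. -/
theorem act_mul_mem (hB : (superalg F).IsSubalg B) (h2 : (2 : F) ≠ 0)
    {p q k l p' q' k' l' u v m n : F} (h : od p q k l ∈ B) (h' : od p' q' k' l' ∈ B)
    (h'' : od u v m n ∈ B) :
    od ((p * k' - p' * k) * n - (p * l' - p' * l) * m)
      ((q * k' - q' * k) * n - (q * l' - q' * l) * m)
      ((q * k' - q' * k) * u - (p * k' - p' * k) * v)
      ((q * l' - q' * l) * u - (p * l' - p' * l) * v) ∈ B := by
  have h1 := hB.mul_mem _ h _ h'
  change mul F _ _ ∈ B at h1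
  rw [mul_od_od] at h1
  have h3 := act_mem hB h2 h1 h''
  have h4 := B.smul_mem (2 * 2) h3
  rw [smul_od] at h4
  refine od_mem_of_eq h4 ?_ ?_ ?_ ?_ <;>
  · field_simp

theorem od_mem_of_basis (hx : od 1 0 0 0 ∈ B) (hy : od 0 1 0 0 ∈ B) (hx' : od 0 0 1 0 ∈ B)
    (hy' : od 0 0 0 1 ∈ B) (p q k l : F) : od p q k l ∈ B := by
  refine od_mem_of_eq (od_comb_mem 1 1 (od_comb_mem p q hx hy) (od_comb_mem k l hx' hy'))
    ?_ ?_ ?_ ?_ <;> ring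

theorem eq_top_of_odd (hB : (superalg F).IsSubalg B) (h2 : (2 : F) ≠ 0) (h3 : (3 : F) ≠ 0)
    (h : ∀ p q k l, od p q k l ∈ B) : B = ⊤ := by
  have hmul (p q k l p' q' k' l' : F) :
      mul F (od p q k l) (od p' q' k' l') ∈ B := hB.mul_mem _ (h ..) _ (h ..)
  have ht (p q k l : F) : ev 0 0 (p * k) (p * l) (q * k) (q * l) ∈ B := by
    have := hmul p q 0 0 0 0 k l
    rw [mul_od_od] at this
    refine ev_mem_of_eq (ev_div_mem (2⁻¹ * 2⁻¹) this) ?_ ?_ ?_ ?_ ?_ ?_ <;> field_simp <;> ring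
  have h5 := hmul 1 0 0 0 0 1 0 0
  rw [mul_od_od] at h5
  -- Here `(x ⊗ x)(y ⊗ y) = (3/4) 1 - e ⊗ e`, whereas `h5` is `e ⊗ e - (3/8) 1`. Their sum is `(3/8)
  -- 1`, which is nonzero because 3 is invertible.
  have h6 : mul F _ _ ∈ B := hB.mul_mem _ (ht 1 0 1 0) _ (ht 0 1 0 1)
  rw [mul_ev_ev] at h6
  have h1 : ev 1 0 0 0 0 0 ∈ B := by
    have h7 := add_mem h5 h6
    rw [ev_add] at h7
    have h9 : (4 : F) = 2 * 2 := by norm_num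
    refine ev_mem_of_eq (ev_div_mem (3 / (2 * 2 * 2)) h7) ?_ ?_ ?_ ?_ ?_ ?_
    · rw [h9]; field_simp; ring
    all_goals ring
  have hE : ev 0 1 0 0 0 0 ∈ B := by
    have h7 := add_mem h5 (B.smul_mem (3 / 4 * 2⁻¹) h1)
    rw [smul_ev, ev_add] at h7
    refine ev_mem_of_eq h7 ?_ ?_ ?_ ?_ ?_ ?_ <;> ring
  rw [Submodule.eq_top_iff']
  intro z
  obtain ⟨r, s, a, b, c, d, p, q, k, l, rfl⟩ := exists_ev_add_od z
  refine add_mem ?_ (h ..)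
  have h7 := add_mem (add_mem (B.smul_mem r h1) (B.smul_mem s hE))
    (add_mem (ht 1 0 a b) (ht 0 1 c d))
  rw [smul_ev, smul_ev, ev_add, ev_add, ev_add] at h7
  refine ev_mem_of_eq h7 ?_ ?_ ?_ ?_ ?_ ?_ <;> ring

/-- An even element sends `e ⊗ y` and `e ⊗ x` to vectors of `V` whose `y ⊗ e` coefficients are `c`
and `-d`, so both vanish. -/
theorem le_subM (hB : (superalg F).IsSubalg B) (h2 : (2 : F) ≠ 0)
    (hx : od 0 0 1 0 ∈ B) (hy : od 0 0 0 1 ∈ B)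
    (hq : ∀ p q k l, od p q k l ∈ B → q = 0) : B ≤ subM F := by
  refine le_of_homogeneous hB fun r s a b c d p q k l he ho => ?_
  have h1 := hq _ _ _ _ (act_mem hB h2 he hy)
  have h4 := hq _ _ _ _ (act_mem hB h2 he hx)
  exact (mem_subM ..).2 ⟨by simpa using h1, by simpa using h4, hq _ _ _ _ ho⟩

/-! ### Every proper subalgebra is carried into one of the four. -/

theorem exists_sl_one_zero {p q : F} (h : ¬(p = 0 ∧ q = 0)) :
    ∃ α β γ δ : F, α * δ - β * γ = 1 ∧ α * p + β * q = 1 ∧ γ * p + δ * q = 0 := by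
  by_cases hp : p = 0
  · have hq : q ≠ 0 := fun hq => h ⟨hp, hq⟩
    exact ⟨0, q⁻¹, -q, 0, by field_simp; ring, by field_simp; ring, by simp [hp]⟩
  · exact ⟨p⁻¹, 0, -q, p, by field_simp; ring, by field_simp; ring, by ring⟩

theorem exists_sl_zero_one {p q : F} (h : ¬(p = 0 ∧ q = 0)) :
    ∃ α β γ δ : F, α * δ - β * γ = 1 ∧ α * p + β * q = 0 ∧ γ * p + δ * q = 1 := by
  obtain ⟨α, β, γ, δ, h, h', h''⟩ := exists_sl_one_zero h
  exact ⟨-γ, -δ, α, β, by linear_combination h, by linear_combination -h'', h'⟩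

/-- `B` is carried into one of the four subalgebras `maxSub` by some automorphism. -/
def IsCovered (B : Submodule F (K10 F)) : Prop :=
  ∃ i, (superalg F).Subconjugate B (maxSub F i)

theorem IsCovered.of_le {i : Fin 4} (h : B ≤ maxSub F i) : IsCovered B :=
  ⟨i, .of_le h⟩

theorem IsCovered.of_map {g : K10 F ≃ₗ[F] K10 F} (hg : (superalg F).IsAut g)
    (h : IsCovered (B.map (g : K10 F →ₗ[F] K10 F))) : IsCovered B :=
  h.imp fun _ => .of_map hg

theorem od_mem_map {g : K10 F ≃ₗ[F] K10 F} {p q k l p' q' k' l' : F} (h : od p q k l ∈ B)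
    (hg : g (od p q k l) = od p' q' k' l') :
    od p' q' k' l' ∈ B.map (g : K10 F →ₗ[F] K10 F) :=
  ⟨_, h, hg⟩

/-- Here `B` contains `W`. As `B` is proper, its projection to `V` is at most a line, which `SL₂`
turns into `F (x ⊗ e)`. -/
theorem isCovered_of_right (hB : (superalg F).IsSubalg B) (hB' : B ≠ ⊤) (h2 : (2 : F) ≠ 0)
    (h3 : (3 : F) ≠ 0) (hx : od 0 0 1 0 ∈ B) (hy : od 0 0 0 1 ∈ B) : IsCovered B := by
  by_cases h : ∀ p q k l, od p q k l ∈ B → p = 0 ∧ q = 0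
  · exact .of_le (i := 2) (le_subM hB h2 hx hy fun p q k l h' => (h p q k l h').2)
  push Not at h
  obtain ⟨p, q, k, l, h, hpq⟩ := h
  obtain ⟨α, β, γ, δ, hd, hp, hq⟩ := exists_sl_one_zero (p := p) (q := q) (by tauto)
  have hg := leftEquiv_isAut hd
  refine .of_map hg (.of_le (i := 2) (le_subM (hB.map hg) h2 (od_mem_map hx ?_)
    (od_mem_map hy ?_) fun p' q' k' l' h' => ?_))
  · simp [leftEquiv_od]
  · simp [leftEquiv_od]
  by_contra hq'
  refine Superalg.map_ne_top hB' (leftEquiv hd) (eq_top_of_odd (hB.map hg) h2 h3 ?_)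
  have hx1 : od 0 0 1 0 ∈ B.map (leftEquiv hd : K10 F →ₗ[F] K10 F) :=
    od_mem_map hx (by simp [leftEquiv_od])
  have hy1 : od 0 0 0 1 ∈ B.map (leftEquiv hd : K10 F →ₗ[F] K10 F) :=
    od_mem_map hy (by simp [leftEquiv_od])
  have h1 : od 1 0 k l ∈ B.map (leftEquiv hd : K10 F →ₗ[F] K10 F) :=
    od_mem_map h (by rw [leftEquiv_od, hp, hq])
  have h4 : od 1 0 0 0 ∈ B.map (leftEquiv hd : K10 F →ₗ[F] K10 F) := by
    refine od_mem_of_eq (od_comb_mem 1 (-1) h1 (od_comb_mem k l hx1 hy1)) ?_ ?_ ?_ ?_ <;> ring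
  refine od_mem_of_basis h4 ?_ hx1 hy1
  refine od_mem_of_eq (od_div_mem q' (od_comb_mem 1 (-1) h'
    (od_comb_mem 1 1 (od_comb_mem p' 0 h4 h4) (od_comb_mem k' l' hx1 hy1)))) ?_ ?_ ?_ ?_ <;>
  · field_simp
    ring

theorem isCovered_of_left (hB : (superalg F).IsSubalg B) (hB' : B ≠ ⊤) (h2 : (2 : F) ≠ 0)
    (h3 : (3 : F) ≠ 0) (hx : od 1 0 0 0 ∈ B) (hy : od 0 1 0 0 ∈ B) : IsCovered B :=
  .of_map swapEquiv_isAut (isCovered_of_right (hB.map swapEquiv_isAut)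
    (Superalg.map_ne_top hB' _) h2 h3 (od_mem_map hx (swap_od ..)) (od_mem_map hy (swap_od ..)))

theorem isCovered_of_left_x (hB : (superalg F).IsSubalg B) (hB' : B ≠ ⊤) (h2 : (2 : F) ≠ 0)
    (h3 : (3 : F) ≠ 0) (hx : od 1 0 0 0 ∈ B) : IsCovered B := by
  by_cases h : ∀ p q k l, od p q k l ∈ B → q = 0
  · by_cases hW : ∀ k l, od 0 0 k l ∈ B → k = 0 ∧ l = 0
    · refine .of_le (i := 2) (le_of_homogeneous hB fun r s a b c d p q k l he ho => ?_)
      -- An even element sends `x ⊗ e` to the vector `(c, d)` of `W`, and `B` meets `W` trivially.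
      have h1 := act_mem hB h2 he hx
      have h4 := hW c d (od_mem_of_eq h1 (by ring) (by ring) (by ring) (by ring))
      exact (mem_subM ..).2 ⟨h4.1, h4.2, h _ _ _ _ ho⟩
    push Not at hW
    obtain ⟨k, l, hkl, h0⟩ := hW
    obtain ⟨α, β, γ, δ, hd, hk, hl⟩ := exists_sl_zero_one (p := k) (q := l) (by tauto)
    have hg := rightEquiv_isAut hd
    refine .of_map hg ?_
    have hC := hB.map hg
    have hC' := Superalg.map_ne_top hB' (rightEquiv hd)
    have h1 : od 1 0 0 0 ∈ B.map (rightEquiv hd : K10 F →ₗ[F] K10 F) :=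
      od_mem_map hx (by simp [rightEquiv_od])
    have h4 : od 0 0 0 1 ∈ B.map (rightEquiv hd : K10 F →ₗ[F] K10 F) :=
      od_mem_map hkl (by rw [rightEquiv_od, hk, hl])
    -- The automorphism acts only on `W`, so the condition `q = 0` survives.
    have h5 (p q k l : F) (h' : od p q k l ∈ B.map (rightEquiv hd : K10 F →ₗ[F] K10 F)) :
        q = 0 := by
      obtain ⟨z, hz, hz'⟩ := h'
      have hz1 : z ∈ part F 1 := by
        have : z = (rightEquiv hd).symm (od p q k l) := by
          rw [← hz']
          simp
        rw [this, ← show _ = part F 1 from hg.symm.map_part 1]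
        exact ⟨_, od_mem_part .., rfl⟩
      obtain ⟨p', q', k', l', rfl⟩ := mem_part_one.1 hz1
      change rightEquiv hd _ = _ at hz'
      rw [rightEquiv_od, od_inj] at hz'
      rw [← hz'.2.1]
      exact h _ _ _ _ hz
    generalize B.map (rightEquiv hd : K10 F →ₗ[F] K10 F) = C at *
    by_cases hk' : ∀ p q k l, od p q k l ∈ C → k = 0
    · refine .of_le (i := 3) (le_of_homogeneous hC fun r s a b c d p q k l he ho => ?_)
      have h6 := hk' _ _ _ _ (act_mem hC h2 he h1)
      exact (mem_subXY ..).2 ⟨by simpa using h6, h5 _ _ _ _ ho, hk' _ _ _ _ ho⟩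
    push Not at hk'
    -- Modulo `x ⊗ e` and `e ⊗ y` this vector is a nonzero multiple of `e ⊗ x`, so `C` contains `W`.
    obtain ⟨p, q, k, l, h6, hk0⟩ := hk'
    obtain rfl := h5 _ _ _ _ h6
    refine isCovered_of_right hC hC' h2 h3 ?_ h4
    refine od_mem_of_eq (od_div_mem k (od_comb_mem 1 (-1) h6 (od_comb_mem p l h1 h4)))
      ?_ ?_ ?_ ?_ <;>
    · field_simp
      ring
  push Not at h
  obtain ⟨p, q, k, l, h, hq⟩ := h
  -- The triple product is `-q` times the `W` component of the vector. Removing that component and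
  -- the multiple of `x ⊗ e` leaves `y ⊗ e`, so `B` contains `V`.
  have h1 := act_mul_mem hB h2 hx h h
  refine isCovered_of_left hB hB' h2 h3 hx ?_
  have h4 : od 0 0 k l ∈ B := by
    refine od_mem_of_eq (od_div_mem (-q) h1) ?_ ?_ ?_ ?_ <;>
    · field_simp
      ring
  refine od_mem_of_eq (od_div_mem q (od_comb_mem 1 (-1) h (od_comb_mem p 1 hx h4))) ?_ ?_ ?_ ?_ <;>
  · field_simp
    ring

theorem isCovered_of_mem_left (hB : (superalg F).IsSubalg B) (hB' : B ≠ ⊤) (h2 : (2 : F) ≠ 0)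
    (h3 : (3 : F) ≠ 0) {p q : F} (h : od p q 0 0 ∈ B) (h0 : ¬(p = 0 ∧ q = 0)) :
    IsCovered B := by
  obtain ⟨α, β, γ, δ, hd, hp, hq⟩ := exists_sl_one_zero h0
  have hg := leftEquiv_isAut hd
  exact .of_map hg (isCovered_of_left_x (hB.map hg) (Superalg.map_ne_top hB' _) h2 h3
    (od_mem_map h (by rw [leftEquiv_od, hp, hq])))

theorem isCovered_of_mem_right (hB : (superalg F).IsSubalg B) (hB' : B ≠ ⊤) (h2 : (2 : F) ≠ 0)
    (h3 : (3 : F) ≠ 0) {k l : F} (h : od 0 0 k l ∈ B) (h0 : ¬(k = 0 ∧ l = 0)) :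
    IsCovered B :=
  .of_map swapEquiv_isAut (isCovered_of_mem_left (hB.map swapEquiv_isAut)
    (Superalg.map_ne_top hB' _) h2 h3 (od_mem_map h (swap_od ..)) h0)

/-- Even elements must preserve the diagonal of `V ⊕ W`. Testing on its two basis vectors gives `2a
= 0`, `2d = 0` and `c = -b`. -/
theorem le_fixedSwap (hB : (superalg F).IsSubalg B) (h2 : (2 : F) ≠ 0)
    (hx : od 1 0 1 0 ∈ B) (hy : od 0 1 0 1 ∈ B)
    (h : ∀ p q k l, od p q k l ∈ B → k = p ∧ l = q) : B ≤ fixedSwap F := by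
  refine le_of_homogeneous hB fun r s a b c d p q k l he ho => ?_
  obtain ⟨h1, h4⟩ := h _ _ _ _ (act_mem hB h2 he hx)
  obtain ⟨h5, h6⟩ := h _ _ _ _ (act_mem hB h2 he hy)
  refine (mem_fixedSwap h2 ..).2 ⟨⟨?_, by simpa using h1, ?_⟩, h _ _ _ _ ho⟩
  · exact (mul_eq_zero.1 (by linear_combination -h5 : 2 * a = 0)).resolve_left h2
  · exact (mul_eq_zero.1 (by linear_combination h4 : 2 * d = 0)).resolve_left h2

theorem rightEquiv_ev {α β γ δ : F} (h : α * δ - β * γ = 1) (r s a b c d : F) :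
    rightEquiv h (ev r s a b c d) =
      ev r s (α * a + β * b) (γ * a + δ * b) (α * c + β * d) (γ * c + δ * d) := by
  have hl (r s a b c d : F) : leftEquiv h (ev r s a b c d) =
    ev r s (α * a + β * c) (α * b + β * d) (γ * a + δ * c) (γ * b + δ * d) := leftMap_ev ..
  simp only [rightEquiv, LinearEquiv.trans_apply, swapEquiv_apply, swap_ev, hl, ev_inj]
  refine ⟨trivial, trivial, ?_, ?_, ?_, ?_⟩ <;> ring

theorem isCovered_of_diag (hB : (superalg F).IsSubalg B) (hB' : B ≠ ⊤) (h2 : (2 : F) ≠ 0)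
    (h3 : (3 : F) ≠ 0) (hx : od 1 0 1 0 ∈ B) : IsCovered B := by
  by_cases hV : ∃ p q, od p q 0 0 ∈ B ∧ ¬(p = 0 ∧ q = 0)
  · obtain ⟨p, q, h, h0⟩ := hV
    exact isCovered_of_mem_left hB hB' h2 h3 h h0
  by_cases hW : ∃ k l, od 0 0 k l ∈ B ∧ ¬(k = 0 ∧ l = 0)
  · obtain ⟨p, q, h, h0⟩ := hW
    exact isCovered_of_mem_right hB hB' h2 h3 h h0
  have hW' (k l : F) (h : od 0 0 k l ∈ B) : k = 0 ∧ l = 0 := by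
    by_contra h0
    exact hW ⟨k, l, h, h0⟩
  by_cases h : ∀ p q k l, od p q k l ∈ B → q = 0
  -- The odd part is the line through `x ⊗ e + e ⊗ x`: subtracting `p` times this vector leaves an
  -- element of `W`.
  · have ho' (p q k l : F) (ho : od p q k l ∈ B) : k - p = 0 ∧ l = 0 := by
      obtain rfl := h _ _ _ _ ho
      exact hW' _ _ (od_mem_of_eq (od_comb_mem 1 (-p) ho hx) (by ring) (by ring) (by ring)
        (by ring))
    -- The rotation `x ↦ y`, `y ↦ -x` of the second factor takes the line to `F (x ⊗ e + e ⊗ y)`,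
    -- which lies in `subXY`. It also turns the coefficient `d`, which vanishes here, into `-c`.
    have hd : (0 : F) * 0 - (-1) * 1 = 1 := by ring
    refine ⟨3, rightEquiv hd, rightEquiv_isAut hd, Submodule.map_le_iff_le_comap.2
      (le_of_homogeneous hB fun r s a b c d p q k l he ho => ?_)⟩
    have h1 := ho' _ _ _ _ (act_mem hB h2 he hx)
    rw [Submodule.mem_comap, LinearEquiv.coe_coe, map_add, rightEquiv_ev, rightEquiv_od]
    refine (mem_subXY ..).2 ⟨?_, h _ _ _ _ ho, ?_⟩
    · linear_combination -h1.2
    · linear_combination -(ho' _ _ _ _ ho).2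
  push Not at h
  obtain ⟨p, q, k, l, h, hq⟩ := h
  obtain ⟨κ, l', h⟩ : ∃ κ l', od 0 1 κ l' ∈ B :=
    ⟨_, _, od_mem_of_eq (od_div_mem q (od_comb_mem 1 (-p) h hx)) (by ring)
      (by field_simp; ring) rfl rfl⟩
  -- The triple product is `-l' (x ⊗ e) - e ⊗ x`. Adding `l'` times `x ⊗ e + e ⊗ x` leaves `(l' - 1)
  -- (e ⊗ x)`, so `l' = 1`.
  have h1 := od_comb_mem 1 l' (act_mul_mem hB h2 hx h hx) hx
  have h4 := (hW' (l' - 1) 0 (od_mem_of_eq h1 (by ring) (by ring) (by ring) (by ring))).1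
  obtain rfl : l' = 1 := sub_eq_zero.1 h4
  -- This shear of `W` fixes `e ⊗ x` and removes the term `κ (e ⊗ x)`, after which the odd part
  -- contains the whole diagonal.
  have hd : (1 : F) * 1 - (-κ) * 0 = 1 := by ring
  have hg := rightEquiv_isAut hd
  refine .of_map hg ?_
  have hC := hB.map hg
  have hC' := Superalg.map_ne_top hB' (rightEquiv hd)
  have hx1 : od 1 0 1 0 ∈ B.map (rightEquiv hd : K10 F →ₗ[F] K10 F) :=
    od_mem_map hx (by simp [rightEquiv_od])
  have hy1 : od 0 1 0 1 ∈ B.map (rightEquiv hd : K10 F →ₗ[F] K10 F) :=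
    od_mem_map h (by simp [rightEquiv_od])
  generalize B.map (rightEquiv hd : K10 F →ₗ[F] K10 F) = C at *
  by_cases hWC : ∃ k l, od 0 0 k l ∈ C ∧ ¬(k = 0 ∧ l = 0)
  · obtain ⟨p, q, h, h0⟩ := hWC
    exact isCovered_of_mem_right hC hC' h2 h3 h h0
  refine .of_le (i := 1) (le_fixedSwap hC h2 hx1 hy1 fun p q k l ho => ?_)
  by_contra h0
  refine hWC ⟨k - p, l - q, ?_, by rwa [sub_eq_zero, sub_eq_zero]⟩
  refine od_mem_of_eq (od_comb_mem 1 (-1) ho (od_comb_mem p q hx1 hy1)) ?_ ?_ ?_ ?_ <;> ring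

/-- Every proper subalgebra is carried into one of the four subalgebras `maxSub`. -/
theorem isCovered (hB : (superalg F).IsSubalg B) (hB' : B ≠ ⊤) (h2 : (2 : F) ≠ 0)
    (h3 : (3 : F) ≠ 0) : IsCovered B := by
  by_cases h : ∀ p q k l, od p q k l ∈ B → p = 0 ∧ q = 0 ∧ k = 0 ∧ l = 0
  · exact .of_le (i := 0) (le_of_homogeneous hB fun r s a b c d p q k l _ ho =>
      (mem_even ..).2 (h _ _ _ _ ho))
  push Not at h
  obtain ⟨p, q, k, l, h, h0⟩ := h
  by_cases hpq : p = 0 ∧ q = 0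
  · obtain ⟨rfl, rfl⟩ := hpq
    exact isCovered_of_mem_right hB hB' h2 h3 h (by tauto)
  by_cases hkl : k = 0 ∧ l = 0
  · obtain ⟨rfl, rfl⟩ := hkl
    exact isCovered_of_mem_left hB hB' h2 h3 h hpq
  obtain ⟨α, β, γ, δ, hd, hp, hq⟩ := exists_sl_one_zero hpq
  obtain ⟨α', β', γ', δ', hd', hk, hl⟩ := exists_sl_one_zero hkl
  have hg := (leftEquiv_isAut hd).trans (rightEquiv_isAut hd')
  exact .of_map hg (isCovered_of_diag (hB.map hg) (Superalg.map_ne_top hB' _) h2 h3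
    (od_mem_map h (by rw [LinearEquiv.trans_apply, leftEquiv_od, rightEquiv_od, hp, hq, hk, hl])))

end K10

/-! ### The four subspaces are proper subalgebras. -/

namespace K10

variable {F : Type*} [Field F]

theorem isSubalg_of_homogeneous {B : Submodule F (K10 F)}
    (hs : ∀ r s a b c d p q k l, ev r s a b c d + od p q k l ∈ B →
      ev r s a b c d ∈ B ∧ od p q k l ∈ B)
    (h00 : ∀ r s a b c d r' s' a' b' c' d', ev r s a b c d ∈ B → ev r' s' a' b' c' d' ∈ B →
      mul F (ev r s a b c d) (ev r' s' a' b' c' d') ∈ B)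
    (h01 : ∀ r s a b c d p q k l, ev r s a b c d ∈ B → od p q k l ∈ B →
      mul F (ev r s a b c d) (od p q k l) ∈ B)
    (h11 : ∀ p q k l p' q' k' l', od p q k l ∈ B → od p' q' k' l' ∈ B →
      mul F (od p q k l) (od p' q' k' l') ∈ B) : (superalg F).IsSubalg B := by
  constructor
  · intro z hz w hw
    obtain ⟨r, s, a, b, c, d, p, q, k, l, rfl⟩ := exists_ev_add_od z
    obtain ⟨r', s', a', b', c', d', p', q', k', l', rfl⟩ := exists_ev_add_od w
    obtain ⟨hz0, hz1⟩ := hs _ _ _ _ _ _ _ _ _ _ hz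
    obtain ⟨hw0, hw1⟩ := hs _ _ _ _ _ _ _ _ _ _ hw
    change mul F _ _ ∈ B
    -- Even and odd elements commute, so `h01` also covers the products in the other order.
    rw [map_add, map_add, LinearMap.add_apply, LinearMap.add_apply, mul_od_ev, ← mul_ev_od]
    exact add_mem (add_mem (h00 _ _ _ _ _ _ _ _ _ _ _ _ hz0 hw0)
      (h01 _ _ _ _ _ _ _ _ _ _ hw0 hz1)) (add_mem (h01 _ _ _ _ _ _ _ _ _ _ hz0 hw1)
      (h11 _ _ _ _ _ _ _ _ hz1 hw1))
  · refine le_antisymm (fun z hz => ?_) (sup_le inf_le_left inf_le_left)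
    obtain ⟨r, s, a, b, c, d, p, q, k, l, rfl⟩ := exists_ev_add_od z
    obtain ⟨hz0, hz1⟩ := hs _ _ _ _ _ _ _ _ _ _ hz
    exact Submodule.add_mem_sup ⟨hz0, ev_mem_part ..⟩ ⟨hz1, od_mem_part ..⟩

theorem ev_mem_iff (B : Submodule F (K10 F)) (r s a b c d : F) :
    ev r s a b c d ∈ B ↔ ev r s a b c d + od 0 0 0 0 ∈ B := by
  rw [od_zero, add_zero]

theorem od_mem_iff (B : Submodule F (K10 F)) (p q k l : F) :
    od p q k l ∈ B ↔ ev 0 0 0 0 0 0 + od p q k l ∈ B := by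
  rw [ev_zero, zero_add]

theorem ev_mem_fixedSwap (h2 : (2 : F) ≠ 0) (r s a b c d : F) :
    ev r s a b c d ∈ fixedSwap F ↔ a = 0 ∧ c = -b ∧ d = 0 := by
  simp [ev_mem_iff, mem_fixedSwap h2]

theorem od_mem_fixedSwap (h2 : (2 : F) ≠ 0) (p q k l : F) :
    od p q k l ∈ fixedSwap F ↔ k = p ∧ l = q := by
  simp [od_mem_iff, mem_fixedSwap h2]

theorem ev_mem_subM (r s a b c d : F) : ev r s a b c d ∈ subM F ↔ c = 0 ∧ d = 0 := by
  simp [ev_mem_iff, mem_subM]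

theorem od_mem_subM (p q k l : F) : od p q k l ∈ subM F ↔ q = 0 := by
  simp [od_mem_iff, mem_subM]

theorem ev_mem_subXY (r s a b c d : F) : ev r s a b c d ∈ subXY F ↔ c = 0 := by
  simp [ev_mem_iff, mem_subXY]

theorem od_mem_subXY (p q k l : F) : od p q k l ∈ subXY F ↔ q = 0 ∧ k = 0 := by
  simp [od_mem_iff, mem_subXY]

theorem od_mem_even (p q k l : F) : od p q k l ∈ part F 0 ↔ p = 0 ∧ q = 0 ∧ k = 0 ∧ l = 0 := by
  simp [od_mem_iff, mem_even]

theorem isSubalg_even : (superalg F).IsSubalg (part F 0) := by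
  refine isSubalg_of_homogeneous ?_ ?_ ?_ ?_
  · simp +contextual [mem_even, od_mem_even, ev_mem_part]
  · intros
    rw [mul_ev_ev]
    exact ev_mem_part ..
  · simp +contextual [mul_ev_od, od_mem_even]
  · intros
    rw [mul_od_od]
    exact ev_mem_part ..

theorem isSubalg_fixedSwap (h2 : (2 : F) ≠ 0) : (superalg F).IsSubalg (fixedSwap F) := by
  refine isSubalg_of_homogeneous ?_ ?_ ?_ ?_
  · simp +contextual [mem_fixedSwap h2, od_mem_fixedSwap h2, ev_mem_fixedSwap h2]
  · intro r s a b c d r' s' a' b' c' d' h h'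
    rw [ev_mem_fixedSwap h2] at h h'
    obtain ⟨rfl, rfl, rfl⟩ := h
    obtain ⟨rfl, rfl, rfl⟩ := h'
    rw [mul_ev_ev, ev_mem_fixedSwap h2]
    refine ⟨?_, ?_, ?_⟩ <;> ring
  · intro r s a b c d p q k l h h'
    rw [ev_mem_fixedSwap h2] at h
    rw [od_mem_fixedSwap h2] at h'
    obtain ⟨rfl, rfl, rfl⟩ := h
    obtain ⟨rfl, rfl⟩ := h'
    rw [mul_ev_od, od_mem_fixedSwap h2]
    refine ⟨?_, ?_⟩ <;> ring
  · intro p q k l p' q' k' l' h h'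
    rw [od_mem_fixedSwap h2] at h h'
    obtain ⟨rfl, rfl⟩ := h
    obtain ⟨rfl, rfl⟩ := h'
    rw [mul_od_od, ev_mem_fixedSwap h2]
    refine ⟨?_, ?_, ?_⟩ <;> ring

theorem isSubalg_subM : (superalg F).IsSubalg (subM F) := by
  refine isSubalg_of_homogeneous ?_ ?_ ?_ ?_
  · simp +contextual [mem_subM, od_mem_subM, ev_mem_subM]
  · simp +contextual [mul_ev_ev, ev_mem_subM]
  · simp +contextual [mul_ev_od, ev_mem_subM, od_mem_subM]
  · simp +contextual [mul_od_od, ev_mem_subM, od_mem_subM]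

theorem isSubalg_subXY : (superalg F).IsSubalg (subXY F) := by
  refine isSubalg_of_homogeneous ?_ ?_ ?_ ?_
  · simp +contextual [mem_subXY, od_mem_subXY, ev_mem_subXY]
  · simp +contextual [mul_ev_ev, ev_mem_subXY]
  · simp +contextual [mul_ev_od, ev_mem_subXY, od_mem_subXY]
  · simp +contextual [mul_od_od, ev_mem_subXY, od_mem_subXY]

theorem isSubalg_maxSub (h2 : (2 : F) ≠ 0) (i : Fin 4) : (superalg F).IsSubalg (maxSub F i) := by
  fin_cases i
  · exact isSubalg_even
  · exact isSubalg_fixedSwap h2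
  · exact isSubalg_subM
  · exact isSubalg_subXY

theorem od_notMem_maxSub (h2 : (2 : F) ≠ 0) (i : Fin 4) : od 0 1 0 0 ∉ maxSub F i := by
  fin_cases i
  · exact fun h => one_ne_zero ((od_mem_even ..).1 h).2.1
  · exact fun h => zero_ne_one ((od_mem_fixedSwap h2 ..).1 h).2
  · exact fun h => one_ne_zero ((od_mem_subM ..).1 h)
  · exact fun h => one_ne_zero ((od_mem_subXY ..).1 h).1

theorem maxSub_ne_top (h2 : (2 : F) ≠ 0) (i : Fin 4) : maxSub F i ≠ ⊤ :=
  fun h => od_notMem_maxSub h2 i (h ▸ Submodule.mem_top)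

/-! ### The four subalgebras are maximal. -/

theorem le_even {C : Submodule F (K10 F)} (hC : (superalg F).IsSubalg C) (hC' : C ≠ ⊤)
    (h2 : (2 : F) ≠ 0) (h3 : (3 : F) ≠ 0) (h : part F 0 ≤ C) : C ≤ part F 0 := by
  obtain ⟨i, g, hg, hi⟩ := isCovered hC hC' h2 h3
  have hp : (part F 0).map (g : K10 F →ₗ[F] K10 F) = part F 0 := hg.map_part 0
  have h0 : part F 0 ≤ maxSub F i := by
    rw [← hp]
    exact (Submodule.map_mono h).trans hi
  -- The element `x ⊗ x + y ⊗ x` lies in none of the other three subalgebras, which require `a = 0`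
  -- or `c = 0`.
  have h1 := h0 (ev_mem_part 0 0 1 0 1 0)
  fin_cases i
  · have hi' : C.map (g : K10 F →ₗ[F] K10 F) ≤ part F 0 := hi
    rw [← hp] at hi'
    rwa [Submodule.map_le_map_iff_of_injective g.injective] at hi'
  · exact absurd ((ev_mem_fixedSwap h2 ..).1 h1).1 one_ne_zero
  · exact absurd ((ev_mem_subM ..).1 h1).1 one_ne_zero
  · exact absurd ((ev_mem_subXY ..).1 h1) one_ne_zero

theorem le_fixedSwap_of_ge {C : Submodule F (K10 F)} (hC : (superalg F).IsSubalg C) (hC' : C ≠ ⊤)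
    (h2 : (2 : F) ≠ 0) (h3 : (3 : F) ≠ 0) (h : fixedSwap F ≤ C) : C ≤ fixedSwap F := by
  have hx : od 1 0 1 0 ∈ C := h ((od_mem_fixedSwap h2 ..).2 ⟨rfl, rfl⟩)
  have hy : od 0 1 0 1 ∈ C := h ((od_mem_fixedSwap h2 ..).2 ⟨rfl, rfl⟩)
  by_cases hW : ∀ k l, od 0 0 k l ∈ C → k = 0 ∧ l = 0
  · refine le_fixedSwap hC h2 hx hy fun p q k l ho => ?_
    have h1 := hW (k - p) (l - q) (by
      refine od_mem_of_eq (od_comb_mem 1 (-1) ho (od_comb_mem p q hx hy)) ?_ ?_ ?_ ?_ <;> ring)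
    rwa [sub_eq_zero, sub_eq_zero] at h1
  push Not at hW
  obtain ⟨k, l, hw, hkl⟩ := hW
  -- Triple products of the vector of `W` with diagonal vectors transport each of its coefficients
  -- to both `x ⊗ e` and `y ⊗ e`. One nonzero coefficient then yields all of `V`, and with the
  -- diagonal all of `W`.
  have ha : od l 0 0 0 ∈ C := by
    refine od_mem_of_eq (od_comb_mem 0 (-1) hw (act_mul_mem hC h2 hx hw hx)) ?_ ?_ ?_ ?_ <;> ring
  have hb : od k 0 0 0 ∈ C := by
    refine od_mem_of_eq (od_comb_mem 1 1 hw (act_mul_mem hC h2 hx hw hy)) ?_ ?_ ?_ ?_ <;> ring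
  have hc : od 0 l 0 0 ∈ C := by
    refine od_mem_of_eq (od_comb_mem 1 (-1) hw (act_mul_mem hC h2 hy hw hx)) ?_ ?_ ?_ ?_ <;> ring
  have hd : od 0 k 0 0 ∈ C := by
    refine od_mem_of_eq (od_comb_mem 0 1 hw (act_mul_mem hC h2 hy hw hy)) ?_ ?_ ?_ ?_ <;> ring
  have hV : od 1 0 0 0 ∈ C ∧ od 0 1 0 0 ∈ C := by
    by_cases hk : k = 0
    · have hl := hkl hk
      exact ⟨od_mem_of_eq (od_div_mem l ha) (div_self hl) (zero_div _) (zero_div _) (zero_div _),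
        od_mem_of_eq (od_div_mem l hc) (zero_div _) (div_self hl) (zero_div _) (zero_div _)⟩
    · exact ⟨od_mem_of_eq (od_div_mem k hb) (div_self hk) (zero_div _) (zero_div _) (zero_div _),
        od_mem_of_eq (od_div_mem k hd) (zero_div _) (div_self hk) (zero_div _) (zero_div _)⟩
  refine absurd (eq_top_of_odd hC h2 h3 (od_mem_of_basis hV.1 hV.2 ?_ ?_)) hC'
  · refine od_mem_of_eq (od_comb_mem 1 (-1) hx hV.1) ?_ ?_ ?_ ?_ <;> ring
  · refine od_mem_of_eq (od_comb_mem 1 (-1) hy hV.2) ?_ ?_ ?_ ?_ <;> ring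

theorem le_subM_of_ge {C : Submodule F (K10 F)} (hC : (superalg F).IsSubalg C) (hC' : C ≠ ⊤)
    (h2 : (2 : F) ≠ 0) (h3 : (3 : F) ≠ 0) (h : subM F ≤ C) : C ≤ subM F := by
  have h0 (p k l : F) : od p 0 k l ∈ C := h ((od_mem_subM ..).2 rfl)
  refine le_subM hC h2 (h0 ..) (h0 ..) fun p q k l ho => ?_
  by_contra hq
  refine hC' (eq_top_of_odd hC h2 h3 (od_mem_of_basis (h0 ..) ?_ (h0 ..) (h0 ..)))
  refine od_mem_of_eq (od_div_mem q (od_comb_mem 1 (-1) ho (h0 p k l))) ?_ ?_ ?_ ?_ <;>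
  · field_simp
    ring

/-- The tensors `x ⊗ x` and `y ⊗ y` lie in `subXY`. The first turns a nonzero `y ⊗ e` coefficient
into `e ⊗ x`, and then all odd vectors appear. The second turns an `e ⊗ x` coefficient into a `y ⊗
e` coefficient, so both vanish. -/
theorem le_subXY_of_ge {C : Submodule F (K10 F)} (hC : (superalg F).IsSubalg C) (hC' : C ≠ ⊤)
    (h2 : (2 : F) ≠ 0) (h3 : (3 : F) ≠ 0) (h : subXY F ≤ C) : C ≤ subXY F := by
  have h0 (p l : F) : od p 0 0 l ∈ C := h ((od_mem_subXY ..).2 ⟨rfl, rfl⟩)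
  have h1 (a d : F) : ev 0 0 a 0 0 d ∈ C := h ((ev_mem_subXY ..).2 rfl)
  have hq (p q k l : F) (ho : od p q k l ∈ C) : q = 0 := by
    by_contra hq
    have hx : od 0 0 1 0 ∈ C := by
      refine od_mem_of_eq (od_div_mem (-q) (od_comb_mem 1 (-1) (act_mem hC h2 (h1 1 0) ho)
        (h0 l 0))) ?_ ?_ ?_ ?_ <;>
      · field_simp
        ring
    refine hC' (eq_top_of_odd hC h2 h3 (od_mem_of_basis (h0 ..) ?_ hx (h0 ..)))
    refine od_mem_of_eq (od_div_mem q (od_comb_mem 1 (-1) ho (od_comb_mem 1 k (h0 p l) hx)))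
      ?_ ?_ ?_ ?_ <;>
    · field_simp
      ring
  have hk (p q k l : F) (ho : od p q k l ∈ C) : k = 0 := by
    simpa using hq _ _ _ _ (act_mem hC h2 (h1 0 1) ho)
  refine le_of_homogeneous hC fun r s a b c d p q k l he ho =>
    (mem_subXY ..).2 ⟨?_, hq _ _ _ _ ho, hk _ _ _ _ ho⟩
  simpa using hk _ _ _ _ (act_mem hC h2 he (h0 1 0))

theorem isMaximalSubalg_maxSub (h2 : (2 : F) ≠ 0) (h3 : (3 : F) ≠ 0) (i : Fin 4) :
    (superalg F).IsMaximalSubalg (maxSub F i) := by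
  refine ⟨⟨isSubalg_maxSub h2 i, maxSub_ne_top h2 i⟩, fun C hC h => ?_⟩
  fin_cases i
  · exact le_even hC.1 hC.2 h2 h3 h
  · exact le_fixedSwap_of_ge hC.1 hC.2 h2 h3 h
  · exact le_subM_of_ge hC.1 hC.2 h2 h3 h
  · exact le_subXY_of_ge hC.1 hC.2 h2 h3 h

/-! ### Dimensions of the even parts and non-conjugacy. -/

variable (F) in
/-- The parametrization of the even part by coordinates. -/
def evMap : (Fin 6 → F) →ₗ[F] K10 F where
  toFun v := ev (v 0) (v 1) (v 2) (v 3) (v 4) (v 5)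
  map_add' _ _ := (ev_add ..).symm
  map_smul' _ _ := (smul_ev ..).symm

theorem evMap_injective : Function.Injective (evMap F) := by
  intro v w h
  obtain ⟨h0, h1, h2, h3, h4, h5⟩ := ev_inj.1 h
  ext i
  fin_cases i <;> assumption

theorem finrank_of_parametrization {n : ℕ} {C : Submodule F (K10 F)}
    (f : (Fin n → F) →ₗ[F] (Fin 6 → F)) (hf : Function.Injective f)
    (h : ∀ r s a b c d, ev r s a b c d ∈ C ↔ ![r, s, a, b, c, d] ∈ LinearMap.range f) :
    Module.finrank F ↥(C ⊓ (superalg F).part 0) = n := by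
  have hr : C ⊓ (superalg F).part 0 = LinearMap.range (evMap F ∘ₗ f) := by
    ext z
    constructor
    · rintro ⟨hz, hz0⟩
      obtain ⟨r, s, a, b, c, d, rfl⟩ := mem_part_zero.1 hz0
      obtain ⟨v, hv⟩ := (h ..).1 hz
      exact ⟨v, by rw [LinearMap.comp_apply, hv]; rfl⟩
    · rintro ⟨v, rfl⟩
      refine ⟨(h ..).2 ⟨v, ?_⟩, ev_mem_part ..⟩
      ext i
      fin_cases i <;> rfl
  have hi : Function.Injective (evMap F ∘ₗ f) := by
    rw [LinearMap.coe_comp]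
    exact evMap_injective.comp hf
  rw [hr, LinearMap.finrank_range_of_inj hi, Module.finrank_fin_fun]

theorem finrank_even_maxSub (h2 : (2 : F) ≠ 0) (i : Fin 4) :
    Module.finrank F ↥(maxSub F i ⊓ (superalg F).part 0) = ![6, 3, 4, 5] i := by
  fin_cases i
  · exact finrank_of_parametrization LinearMap.id Function.injective_id fun r s a b c d =>
      ⟨fun _ => ⟨_, rfl⟩, fun _ => ev_mem_part ..⟩
  · refine finrank_of_parametrization (n := 3)
      (LinearMap.pi ![.proj 0, .proj 1, 0, .proj 2, -.proj 2, 0]) ?_ ?_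
    · intro v w h
      ext i
      fin_cases i
      · exact congrFun h 0
      · exact congrFun h 1
      · exact congrFun h 3
    · intro r s a b c d
      refine (ev_mem_fixedSwap h2 ..).trans ⟨?_, ?_⟩
      · rintro ⟨rfl, rfl, rfl⟩
        refine ⟨![r, s, b], ?_⟩
        ext i
        fin_cases i <;> simp
      · rintro ⟨v, hv⟩
        have h3 := congrFun hv 3
        have h4 := congrFun hv 4
        simp at h3 h4
        exact ⟨(congrFun hv 2).symm, by rw [← h3, ← h4], (congrFun hv 5).symm⟩
  · refine finrank_of_parametrization (n := 4)
      (LinearMap.pi ![.proj 0, .proj 1, .proj 2, .proj 3, 0, 0]) ?_ ?_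
    · intro v w h
      ext i
      fin_cases i
      · exact congrFun h 0
      · exact congrFun h 1
      · exact congrFun h 2
      · exact congrFun h 3
    · intro r s a b c d
      refine (ev_mem_subM ..).trans ⟨?_, ?_⟩
      · rintro ⟨rfl, rfl⟩
        refine ⟨![r, s, a, b], ?_⟩
        ext i
        fin_cases i <;> simp
      · rintro ⟨v, hv⟩
        exact ⟨(congrFun hv 4).symm, (congrFun hv 5).symm⟩
  · refine finrank_of_parametrization (n := 5)
      (LinearMap.pi ![.proj 0, .proj 1, .proj 2, .proj 3, 0, .proj 4]) ?_ ?_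
    · intro v w h
      ext i
      fin_cases i
      · exact congrFun h 0
      · exact congrFun h 1
      · exact congrFun h 2
      · exact congrFun h 3
      · exact congrFun h 5
    · intro r s a b c d
      refine (ev_mem_subXY ..).trans ⟨?_, ?_⟩
      · rintro rfl
        refine ⟨![r, s, a, b, d], ?_⟩
        ext i
        fin_cases i <;> simp
      · rintro ⟨v, hv⟩
        exact (congrFun hv 4).symm

theorem not_conjugate_maxSub (h2 : (2 : F) ≠ 0) {i j : Fin 4} (hij : i ≠ j) :
    ¬(superalg F).Conjugate (maxSub F i) (maxSub F j) := by
  intro h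
  have h1 := h.finrank_inf_part 0
  rw [finrank_even_maxSub h2, finrank_even_maxSub h2] at h1
  have hinj : Function.Injective (![6, 3, 4, 5] : Fin 4 → ℕ) := by decide
  exact hij (hinj h1)

end K10

/-! ### Maximality of `M` in `K3`. -/

namespace K3

variable {F : Type*} [Field F]

theorem mem_M {a : K3 F} : a ∈ M F ↔ a 2 = 0 := by
  rw [M, Submodule.mem_span_pair]
  constructor
  · rintro ⟨c, d, rfl⟩
    simp [e, x]
  · intro h
    refine ⟨a 0, a 1, ?_⟩
    ext k
    fin_cases k <;> simp [e, x, h]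

/-- `M` is closed under the product and has codimension one, so no proper subspace is strictly
larger. -/
theorem isMaximalSubalg_M : (superalg F).IsMaximalSubalg (M F) := by
  refine ⟨⟨⟨?_, ?_⟩, fun h => ?_⟩, fun C hC h => ?_⟩
  · intro a ha b hb
    rw [mem_M] at ha hb
    exact mem_M.2 (by simp [superalg, mul, ha, hb])
  · refine le_antisymm (fun a ha => ?_) (sup_le inf_le_left inf_le_left)
    rw [mem_M] at ha
    rw [← proj_add a]
    exact Submodule.add_mem_sup ⟨mem_M.2 (by simp [proj_zero]), proj_mem 0 a⟩
      ⟨mem_M.2 (by simp [proj_one, ha]), proj_mem 1 a⟩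
  · have hy : y F ∈ M F := h ▸ Submodule.mem_top
    simp [mem_M, y] at hy
  · intro a ha
    rw [mem_M]
    by_contra h0
    refine hC.2 ((Submodule.eq_top_iff').2 fun b => ?_)
    have hM : b - (b 2 / a 2) • a ∈ M F := mem_M.2 (by simp [h0])
    have := add_mem (h hM) (C.smul_mem (b 2 / a 2) ha)
    rwa [sub_add_cancel] at this

end K3

theorem corollary4p2 {F : Type*} [Field F] [IsAlgClosed F]
    (h2 : (2 : F) ≠ 0) (h3 : (3 : F) ≠ 0) :
    (∃ g : K10 F ≃ₗ[F] K10 F, (K10.superalg F).IsAut g ∧ ∀ z, g z = K10.swap F z) ∧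
    (K3.superalg F).IsMaximalSubalg (K3.M F) ∧
    (∀ B : Submodule F (K10 F), (K10.superalg F).IsMaximalSubalg B ↔
      ∃ i : Fin 4, (K10.superalg F).Conjugate B (K10.maxSub F i)) ∧
    (∀ i j : Fin 4, i ≠ j →
      ¬ (K10.superalg F).Conjugate (K10.maxSub F i) (K10.maxSub F j)) := by
  refine ⟨⟨K10.swapEquiv F, K10.swapEquiv_isAut, fun _ => rfl⟩, K3.isMaximalSubalg_M,
    fun B => ⟨fun hB => ?_, ?_⟩, fun i j hij => K10.not_conjugate_maxSub h2 hij⟩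
  · obtain ⟨i, hi⟩ := K10.isCovered hB.1.1 hB.1.2 h2 h3
    exact ⟨i, hB.conjugate (K10.isSubalg_maxSub h2 i) (K10.maxSub_ne_top h2 i) hi⟩
  · rintro ⟨i, hi⟩
    exact hi.isMaximalSubalg (K10.isMaximalSubalg_maxSub h2 h3 i)
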